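/- **Model.** Let $n\ge 1$ and $f\ge 0$ be integers with $f<n/2$. Consider an asynchronous system of $n$ processes $p_1,\dots,p_n$ with identifiers $\Pi=\{1,\dots,n\}$ that exchange messages. Messages are neither created, altered nor duplicated by the network, may be delivered with arbitrary finite delays and in any order, and every message sent by a correct process to a correct process is eventually received. Handlers are executed atomically. A process may crash, after which it takes no more steps; a process is *faulty* in an execution if it crashes in it, and *correct* otherwise. At most $f$ processes are faulty in any execution. **Shared memory.** There is a set of registers with integer values, initially $0$. Processes invoke operations $\mathrm{READ}(r)$, which return a value, and $\mathrm{WRITE}(r,v)$, which return OK; a process may invoke an operation only if it has no outstanding one. The *history* of an execution is the (finite or infinite) sequence of its invocation and response events, in the order in which they occur; $H|p_i$ is the subsequence of the events of $H$ that occur in $p_i$. A history is *complete* if every invocation in it has a matching response. It is *sequential* if it alternates between invocations and responses, starting with an invocation (unless it is empty), each response matching the invocation immediately before it; it may end in an invocation. A sequential history is *legal* if each read that completes in it returns the value written by the last preceding write to the same register, or $0$ if there is none. A history $H$ is *sequentially consistent* if there is a legal sequential history $S$ with $S|p_i=H|p_i$ for every $i\in\Pi$. **Algorithm SC-ABD.**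 Timestamps are pairs (logical time, process identifier); timestamps, and timestamp-value pairs, are ordered lexicographically. Process $p_i$ has the variables $lt=0$ (logical time), $rid=0$ (request identifier), $tvps$ (a map from registers to timestamp-value pairs, initially constant $((0,0),0)$), $responses=\emptyset$, and $reading$, $rreg$, $rval$ (initially arbitrary). To broadcast is to send to all processes, including oneself. The handlers of $p_i$ are: * $\mathrm{READ}(r)$ is invoked: $lt\gets lt+1$; $reading\gets true$; $rreg\gets r$; $rid\gets rid+1$; broadcast $\langle\text{query},lt,rid,r\rangle$. * $\langle\text{query},lt',rid',r\rangle$ is received from $p_j$: $lt\gets\max(lt,lt')+1$; send $\langle\text{response},lt,rid',tvps[r]\rangle$ to $p_j$. * $\langle\text{response},lt',rid',tsv'\rangle$ is received from $p_j$ with $rid=rid'$: $lt\gets\max(lt,lt')+1$; $responses\gets responses\cup\{(tsv',j)\}$; if $|responses|=\lfloor n/2\rfloor+1$ then let $(tsv,\_)$ be the maximum of $responses$, set $rval$ to the value in $tsv$, $responses\gets\emptyset$, $rid\gets rid+1$, and broadcast $\langle\text{update},lt,rid,rreg,tsv\rangle$. * $\mathrm{WRITE}(r,v)$ is invoked: $lt\gets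 lt+1$; $reading\gets false$; $tsv\gets((lt,i),v)$; $rid\gets rid+1$; broadcast $\langle\text{update},lt,rid,r,tsv\rangle$. * $\langle\text{update},lt',rid',r,tsv'\rangle$ is received from $p_j$: $lt\gets\max(lt,lt')+1$; $tvps[r]\gets\max(tvps[r],tsv')$; send $\langle\text{ack},lt,rid'\rangle$ to $p_j$. * $\langle\text{ack},lt',rid'\rangle$ is received from $p_j$ with $rid=rid'$: $lt\gets\max(lt,lt')+1$; $responses\gets responses\cup\{j\}$; if $|responses|=\lfloor n/2\rfloor+1$ then $responses\gets\emptyset$, $rid\gets rid+1$, and the outstanding operation returns $rval$ if $reading$, and OK otherwise. Responses and acks with $rid\ne rid'$ are ignored. **Theorem.** Algorithm SC-ABD is a correct implementation of sequentially consistent distributed shared memory, that is, in this model: 1. (Termination) in every execution, every operation invoked by a correct process eventually completes; 2. (Sequential consistency) for every execution, if its history is complete, then its history is sequentially consistent. This holds for finite and infinite executions, and does not need the assumption that messages are eventually received. -/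

import Mathlib

namespace SCABD

/-! ### Operations, events, and histories -/

/-- Operations on integer-valued registers with identifiers in `X`. -/
inductive Op (X : Type*) where
  | read (r : X)
  | write (r : X) (v : ℤ)

/-- Results of operations: a read returns a value, a write returns `OK`. -/
inductive Ret where
  | value (v : ℤ)
  | ok

/-- The result `a` is of the kind that the operation returns. -/
def Op.Accepts {X : Type*} : Op X → Ret → Prop
  | .read _, .value _ => True
  | .write _ _, .ok => True
  | _, _ => False

/-- Invocation and response events, with the process where they occur. As a process has at most
one outstanding operation, the operation to which a response belongs is the last one that the
process invoked. -/
inductive Event (X : Type*) (n : ℕ) where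
  | inv (p : Fin n) (o : Op X)
  | res (p : Fin n) (a : Ret)

/-- The process where an event occurs. -/
def Event.proc {X : Type*} {n : ℕ} : Event X n → Fin n
  | .inv p _ => p
  | .res p _ => p

/-- The `k`-th entry (from `0`) among the entries `some a` of `s`, or `none` if there are at most
`k` of them. -/
noncomputable def nthEntry {α : Type*} (s : ℕ → Option α) (k : ℕ) : Option α :=
  open Classical in
  if ∀ h : {t | (s t).isSome = true}.Finite, k < h.toFinset.card then
    s (Nat.nth (fun t => (s t).isSome = true) k)
  else none

theorem nthEntry_isSeq {α : Type*} (s : ℕ → Option α) : Stream'.IsSeq (nthEntry s) := by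
  intro k hk
  have hk' : nthEntry s k = none := hk
  change nthEntry s (k + 1) = none
  unfold nthEntry at hk' ⊢
  split_ifs at hk' with h
  · have := Nat.nth_mem (p := fun t => (s t).isSome = true) k h
    simp [hk'] at this
  · rw [if_neg]
    intro h'
    exact h fun hf => lt_trans (Nat.lt_succ_self k) (h' hf)

/-- The finite or infinite sequence of the `a` with `some a` an entry of `s`, in the same order. -/
noncomputable def compact {α : Type*} (s : ℕ → Option α) : Stream'.Seq α :=
  ⟨nthEntry s, nthEntry_isSeq s⟩

/-- A history: a finite or infinite sequence of events. -/
abbrev History (X : Type*) (n : ℕ) := Stream'.Seq (Event X n)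

namespace History

variable {X : Type*} {n : ℕ}

/-- The process subhistory: the subsequence of the events that occur in process `p`. -/
noncomputable def proj (H : History X n) (p : Fin n) : History X n :=
  compact fun k => (H.get? k).filter fun e => decide (e.proc = p)

/-- Equivalent histories have the same process subhistories. -/
def Equivalent (H H' : History X n) : Prop :=
  ∀ p, H.proj p = H'.proj p

/-- The history is an alternating sequence of invocations and matching responses, starting with an
invocation (if it is not empty); it may end in an invocation. -/
def Sequential (H : History X n) : Prop :=
  (∀ k e, H.get? (2 * k) = some e → ∃ p o, e = Event.inv p o) ∧
  (∀ k e, H.get? (2 * k + 1) = some e →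
    ∃ p o a, H.get? (2 * k) = some (Event.inv p o) ∧ e = Event.res p a ∧ o.Accepts a)

/-- The value written by the last write to `r` invoked among the first `k` events, and `0` if there
is no such write. -/
noncomputable def regValue (H : History X n) (r : X) : ℕ → ℤ
  | 0 => 0
  | k + 1 =>
    match H.get? k with
    | some (Event.inv _ (Op.write r' v)) =>
      open Classical in if r' = r then v else regValue H r k
    | _ => regValue H r k

/-- The sequential specification of read/write registers that are initially zero. -/
def Legal (S : History X n) : Prop :=
  S.Sequential ∧
  ∀ k p q r v, S.get? k = some (Event.inv p (Op.read r)) →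
    S.get? (k + 1) = some (Event.res q (Ret.value v)) → v = regValue S r k

/-- Sequential consistency. -/
def SC (H : History X n) : Prop :=
  ∃ S : History X n, S.Legal ∧ S.Equivalent H

/-- The operation invoked at position `k` of the history completes: a matching response occurs at a
later position `l`, and it is the next event of the invoking process. -/
def CompletesAt (H : History X n) (k : ℕ) : Prop :=
  ∃ p o l a, k < l ∧ H.get? k = some (Event.inv p o) ∧ H.get? l = some (Event.res p a) ∧
    o.Accepts a ∧ ∀ m e, k < m → m < l → H.get? m = some e → e.proc ≠ p

/-- No operation is pending. -/
def Complete (H : History X n) : Prop :=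
  ∀ k p o, H.get? k = some (Event.inv p o) → H.CompletesAt k

end History

/-! ### The algorithm -/

/-- Timestamps (logical time, process identifier), ordered lexicographically. -/
abbrev Timestamp := ℕ ×ₗ ℕ

/-- Timestamp-value pairs. -/
abbrev TSV := Timestamp ×ₗ ℤ

/-- The process with index `i : Fin n` has the identifier `i + 1` in `{1, …, n}`. -/
def pid {n : ℕ} (i : Fin n) : ℕ := (i : ℕ) + 1

/-- Messages. -/
inductive Msg (X : Type*) where
  | query (lt rid : ℕ) (r : X)
  | response (lt rid : ℕ) (tsv : TSV)
  | update (lt rid : ℕ) (r : X) (tsv : TSV)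
  | ack (lt rid : ℕ)

/-- A message with its sender and its addressee. -/
structure Packet (X : Type*) (n : ℕ) where
  src : Fin n
  dst : Fin n
  msg : Msg X

/-- The local variables of a process. The set of responses is kept as two sets, by type: the
answers to a query with their senders, and the senders of acknowledgements. -/
structure ProcState (X : Type*) (n : ℕ) where
  lt : ℕ
  rid : ℕ
  tvps : X → TSV
  responses : Finset (TSV ×ₗ Fin n)
  acks : Finset (Fin n)
  reading : Bool
  rreg : X
  rval : ℤ

/-- Initial local states; `reading`, `rreg` and `rval` are not constrained. -/
def ProcState.Initial {X : Type*} {n : ℕ} (s : ProcState X n) : Prop :=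
  s.lt = 0 ∧ s.rid = 0 ∧ (∀ r, s.tvps r = toLex (toLex (0, 0), 0)) ∧
    s.responses = ∅ ∧ s.acks = ∅

/-- The effect of the execution of a handler: the new local state, the messages sent, and the
result returned to the caller, if any. -/
structure Effect (X : Type*) (n : ℕ) where
  state : ProcState X n
  sends : Multiset (Packet X n)
  ret : Option Ret

section Handlers

variable {X : Type*} {n : ℕ}

/-- Send `m` to all processes, including the sender `i`. -/
def bcast (i : Fin n) (m : Msg X) : Multiset (Packet X n) :=
  (Finset.univ : Finset (Fin n)).val.map fun j => ⟨i, j, m⟩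

/-- The size of a majority, `⌊n / 2⌋ + 1`. -/
def quorum (n : ℕ) : ℕ := n / 2 + 1

/-- Process `i` in local state `s` executes the handler of an invocation. -/
def onInvoke (i : Fin n) (s : ProcState X n) : Op X → Effect X n
  | .read r =>
    let lt := s.lt + 1
    let rid := s.rid + 1
    { state := { s with lt := lt, reading := true, rreg := r, rid := rid }
      sends := bcast i (.query lt rid r)
      ret := none }
  | .write r v =>
    let lt := s.lt + 1
    let rid := s.rid + 1
    { state := { s with lt := lt, reading := false, rid := rid }
      sends := bcast i (.update lt rid r (toLex (toLex (lt, pid i), v)))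
      ret := none }

/-- Process `i` in local state `s` receives a message from process `j`. Responses and acks with a
request identifier other than the current one have no effect. -/
noncomputable def onReceive (i : Fin n) (s : ProcState X n) (j : Fin n) : Msg X → Effect X n
  | .query lt' rid' r =>
    let lt := max s.lt lt' + 1
    { state := { s with lt := lt }
      sends := {⟨i, j, .response lt rid' (s.tvps r)⟩}
      ret := none }
  | .response lt' rid' tsv' =>
    if s.rid = rid' then
      let lt := max s.lt lt' + 1
      let responses := insert (toLex (tsv', j)) s.responses
      if responses.card = quorum n then
        let tsv : TSV := (ofLex (responses.max' (Finset.insert_nonempty _ _))).1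
        let rid := s.rid + 1
        { state := { s with lt := lt, rval := (ofLex tsv).2, responses := ∅, rid := rid }
          sends := bcast i (.update lt rid s.rreg tsv)
          ret := none }
      else
        { state := { s with lt := lt, responses := responses }, sends := 0, ret := none }
    else { state := s, sends := 0, ret := none }
  | .update lt' rid' r tsv' =>
    let lt := max s.lt lt' + 1
    { state := { s with
        lt := lt
        tvps := open Classical in Function.update s.tvps r (max (s.tvps r) tsv') }
      sends := {⟨i, j, .ack lt rid'⟩}
      ret := none }
  | .ack lt' rid' =>
    if s.rid = rid' then
      let lt := max s.lt lt' + 1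
      let acks := insert j s.acks
      if acks.card = quorum n then
        { state := { s with lt := lt, acks := ∅, rid := s.rid + 1 }
          sends := 0
          ret := some (if s.reading then Ret.value s.rval else Ret.ok) }
      else
        { state := { s with lt := lt, acks := acks }, sends := 0, ret := none }
    else { state := s, sends := 0, ret := none }

end Handlers

/-! ### Executions -/

/-- A global state of the system. -/
structure Config (X : Type*) (n : ℕ) where
  /-- the local states of the processes -/
  procs : Fin n → ProcState X n
  /-- the messages that have been sent and not yet received -/
  transit : Multiset (Packet X n)
  /-- the processes that have an outstanding operation -/
  busy : Finset (Fin n)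
  /-- the processes that have crashed -/
  crashed : Finset (Fin n)

/-- Initial global states. -/
def Config.Initial {X : Type*} {n : ℕ} (c : Config X n) : Prop :=
  (∀ i, (c.procs i).Initial) ∧ c.transit = 0 ∧ c.busy = ∅ ∧ c.crashed = ∅

/-- What may happen in a step of the system. -/
inductive Step (X : Type*) (n : ℕ) where
  | idle
  | crash (i : Fin n)
  | invoke (i : Fin n) (o : Op X)
  | receive (m : Packet X n)

/-- `Trans c s ev c'`: the step `s` leads from the global state `c` to `c'`, and `ev` is the
invocation or response event that occurs in it, if any. Any message in transit to a process that
has not crashed can be received, in any order; a message is received at most once. -/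
inductive Trans {X : Type*} {n : ℕ} :
    Config X n → Step X n → Option (Event X n) → Config X n → Prop where
  | idle (c : Config X n) : Trans c .idle none c
  | crash (c : Config X n) (i : Fin n) (hi : i ∉ c.crashed) :
      Trans c (.crash i) none { c with crashed := insert i c.crashed }
  | invoke (c : Config X n) (i : Fin n) (o : Op X) (hi : i ∉ c.crashed) (hb : i ∉ c.busy) :
      Trans c (.invoke i o) (some (.inv i o))
        { c with
          procs := Function.update c.procs i (onInvoke i (c.procs i) o).state
          transit := c.transit + (onInvoke i (c.procs i) o).sends
          busy := insert i c.busy }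
  | receive (c : Config X n) (m : Packet X n) (rest : Multiset (Packet X n))
      (hm : c.transit = m ::ₘ rest) (hi : m.dst ∉ c.crashed) :
      Trans c (.receive m)
        ((onReceive m.dst (c.procs m.dst) m.src m.msg).ret.map (Event.res m.dst))
        { c with
          procs := Function.update c.procs m.dst
            (onReceive m.dst (c.procs m.dst) m.src m.msg).state
          transit := rest + (onReceive m.dst (c.procs m.dst) m.src m.msg).sends
          busy := if (onReceive m.dst (c.procs m.dst) m.src m.msg).ret.isSome
            then c.busy.erase m.dst else c.busy }

/-- An execution of the algorithm by `n` processes. Idle steps are allowed, so that finite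
executions are included (as those that are idle from some time on). -/
structure Execution (X : Type*) (n : ℕ) where
  config : ℕ → Config X n
  step : ℕ → Step X n
  event : ℕ → Option (Event X n)
  initial : (config 0).Initial
  trans : ∀ t, Trans (config t) (step t) (event t) (config (t + 1))

namespace Execution

variable {X : Type*} {n : ℕ}

/-- The faulty processes: those that crash. All others are correct. -/
def faulty (E : Execution X n) : Set (Fin n) :=
  {i | ∃ t, i ∈ (E.config t).crashed}

/-- Every message sent by a correct process to a correct process is eventually received. -/
def EventualDelivery (E : Execution X n) : Prop :=
  ∀ t m, m ∈ (E.config t).transit → m.src ∉ E.faulty → m.dst ∉ E.faulty →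
    ∃ t', t ≤ t' ∧ E.step t' = .receive m

/-- The history of an execution: the sequence of its invocation and response events. -/
noncomputable def history (E : Execution X n) : History X n :=
  compact E.event

/-- Every operation invoked by a correct process completes. -/
def Terminates (E : Execution X n) : Prop :=
  ∀ k i o, E.history.get? k = some (Event.inv i o) → i ∉ E.faulty → E.history.CompletesAt k

end Execution

end SCABD

/-! Safety. Time is measured by the logical clocks. An operation x has a logical interval from L(x),
the clock of its process just after the invocation, to R(x), that clock just after the response; let
τ(x) be the pair carried by its update. Each member of some majority stores at least τ(x) at a
moment when its own clock is at most R(x) (`Execution.Secured`). If x is a read, each member of some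
majority stores at most τ(x) at a moment when its clock exceeds L(x) (`Execution.Sampled`).
Majorities meet, and clocks and stored pairs only grow, so R(x) < L(y) implies τ(x) ≤ τ(y) when y is
a read of the same register (`Execution.le_of_secured_of_sampled`). When y is a write, the time in
τ(x) is at most R(x), hence below L(y), which is the time in τ(y).

So sorting the operations on one register by τ, with a write before the reads of its pair, respects
precedence in logical time: each register is linearizable in logical time. This property is local.
Put x at the point K(x), the largest stamp (L, process) among the operations on its register that
are not after x. This point lies in the logical interval of x, and sorting by K merges the orders of
all registers. Successive operations of one process have disjoint logical intervals, so process
order is kept; stamps are distinct naturals and bounded by K, so every operation has finitely many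
predecessors. `sc_of_linearOrder` turns such an order into a legal sequential history, and
`exists_opRecord` extracts the facts about τ from the invariant.

Termination. While a client waits, each process either has been heard from or accounts for exactly
one packet in transit in the current request (`NetOK`). The request identifier rises at most once
while an operation is pending, so in an operation that never returns it is eventually constant. From
then on all correct processes are heard from, and they form a majority, which would have ended the
phase. -/

namespace SCABD

/-! ### Subsequences of optional streams -/

section Sequences

variable {α : Type*}

/-- Positions become counts of earlier entries, so that later arguments can speak of times in the
execution. -/
theorem compact_get?_eq_some {s : ℕ → Option α} {k : ℕ} {a : α} :
    (compact s).get? k = some a ↔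
      ∃ t, s t = some a ∧ Nat.count (fun t => (s t).isSome = true) t = k := by
  change nthEntry s k = some a ↔ _
  unfold nthEntry
  constructor
  · intro h
    split_ifs at h with h'
    exact ⟨_, h, Nat.count_nth h'⟩
  · rintro ⟨t, ht, rfl⟩
    have hp : (s t).isSome = true := by simp [ht]
    rw [if_pos fun hf => Nat.count_lt_card hf hp,
      Nat.nth_count (p := fun t => (s t).isSome = true) hp, ht]

theorem seq_ext_some {s s' : Stream'.Seq α}
    (h : ∀ k a, s.get? k = some a ↔ s'.get? k = some a) : s = s' := by
  apply Stream'.Seq.ext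
  intro k
  apply Option.ext
  exact h k

/-- `φ` maps the entries of `s'` before `m` bijectively onto the entries of `s` before `φ m`, so
corresponding entries have the same position. -/
theorem compact_eq_compact_of_strictMonoOn {s s' : ℕ → Option α} (φ : ℕ → ℕ)
    (hval : ∀ m a, s' m = some a → s (φ m) = some a)
    (hmono : ∀ m m', (s' m).isSome = true → (s' m').isSome = true → m < m' → φ m < φ m')
    (hsurj : ∀ t, (s t).isSome = true → ∃ m, (s' m).isSome = true ∧ φ m = t) :
    compact s' = compact s := by
  have hcount : ∀ m, (s' m).isSome = true →
      Nat.count (fun t => (s' t).isSome = true) m =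
        Nat.count (fun t => (s t).isSome = true) (φ m) := by
    intro m hm
    rw [Nat.count_eq_card_filter_range, Nat.count_eq_card_filter_range]
    refine Finset.card_bij (fun x _ => φ x) ?_ ?_ ?_
    · intro x hx
      simp only [Finset.mem_filter, Finset.mem_range] at hx ⊢
      obtain ⟨a, ha⟩ := Option.isSome_iff_exists.1 hx.2
      exact ⟨hmono _ _ hx.2 hm hx.1, by simp [hval _ _ ha]⟩
    · intro x hx y hy hxy
      simp only [Finset.mem_filter, Finset.mem_range] at hx hy
      rcases lt_trichotomy x y with h | h | h
      · exact absurd hxy (hmono _ _ hx.2 hy.2 h).ne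
      · exact h
      · exact absurd hxy (hmono _ _ hy.2 hx.2 h).ne'
    · intro t ht
      simp only [Finset.mem_filter, Finset.mem_range] at ht
      obtain ⟨x, hx, rfl⟩ := hsurj t ht.2
      refine ⟨x, ?_, rfl⟩
      simp only [Finset.mem_filter, Finset.mem_range]
      refine ⟨?_, hx⟩
      by_contra hlt
      rcases (not_lt.1 hlt).eq_or_lt with h | h
      · exact absurd ht.1 (by simp [h])
      · exact absurd ht.1 (hmono _ _ hm hx h).not_gt
  apply seq_ext_some
  intro k a
  rw [compact_get?_eq_some, compact_get?_eq_some]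
  constructor
  · rintro ⟨m, hm, rfl⟩
    exact ⟨φ m, hval _ _ hm, (hcount m (by simp [hm])).symm⟩
  · rintro ⟨t, ht, rfl⟩
    obtain ⟨m, hm, rfl⟩ := hsurj t (by simp [ht])
    obtain ⟨b, hb⟩ := Option.isSome_iff_exists.1 hm
    have := hval _ _ hb
    rw [ht] at this
    cases this
    exact ⟨m, hb, hcount m hm⟩

/-- This reduces a process subhistory of an execution to a filter of its event stream; the order
isomorphism is `Nat.nth`. -/
theorem compact_filter_compact (s : ℕ → Option α) (q : α → Bool) :
    compact (fun k => ((compact s).get? k).filter q) = compact fun t => (s t).filter q := by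
  have key : ∀ k a, (compact s).get? k = some a →
      s (Nat.nth (fun t => (s t).isSome = true) k) = some a ∧
      Nat.count (fun t => (s t).isSome = true)
        (Nat.nth (fun t => (s t).isSome = true) k) = k := by
    intro k a h
    obtain ⟨t, ht, rfl⟩ := compact_get?_eq_some.1 h
    have hp : (s t).isSome = true := by simp [ht]
    rw [Nat.nth_count (p := fun t => (s t).isSome = true) hp]
    exact ⟨ht, rfl⟩
  refine compact_eq_compact_of_strictMonoOn (Nat.nth fun t => (s t).isSome = true) ?_ ?_ ?_
  · intro m a h
    rw [Option.filter_eq_some_iff] at h ⊢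
    exact ⟨(key _ _ h.1).1, h.2⟩
  · intro m m' hm hm' hlt
    obtain ⟨a, ha⟩ := Option.isSome_iff_exists.1 hm
    obtain ⟨a', ha'⟩ := Option.isSome_iff_exists.1 hm'
    rw [Option.filter_eq_some_iff] at ha ha'
    have h1 := (key _ _ ha.1).2
    have h2 := (key _ _ ha'.1).2
    by_contra hle
    have := Nat.count_monotone (fun t => (s t).isSome = true) (not_lt.1 hle)
    omega
  · intro t ht
    obtain ⟨a, ha⟩ := Option.isSome_iff_exists.1 ht
    rw [Option.filter_eq_some_iff] at ha
    have hp : (s t).isSome = true := by simp [ha.1]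
    refine ⟨Nat.count (fun t => (s t).isSome = true) t, ?_, Nat.nth_count hp⟩
    rw [Option.isSome_iff_exists]
    refine ⟨a, ?_⟩
    rw [Option.filter_eq_some_iff, compact_get?_eq_some]
    exact ⟨⟨t, ha.1, rfl⟩, ha.2⟩

theorem count_isSome_lt {s : ℕ → Option α} {t u : ℕ} {a : α} (ht : s t = some a)
    (h : t < u) : Nat.count (fun t => (s t).isSome = true) t <
      Nat.count (fun t => (s t).isSome = true) u :=
  Nat.count_strict_mono (by simp [ht]) h

theorem lt_of_count_isSome_lt {s : ℕ → Option α} {t u : ℕ}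
    (h : Nat.count (fun t => (s t).isSome = true) t <
      Nat.count (fun t => (s t).isSome = true) u) : t < u :=
  Nat.lt_of_count_lt_count h

end Sequences

/-! ### Completion of operations, in terms of times -/

section Completion

variable {X : Type*} {n : ℕ}

/-- The operation invoked at time `t` completes at time `u` with result `a`. -/
def CompletesBetween (s : ℕ → Option (Event X n)) (t u : ℕ) (p : Fin n) (o : Op X)
    (a : Ret) : Prop :=
  t < u ∧ s t = some (.inv p o) ∧ s u = some (.res p a) ∧ o.Accepts a ∧
    ∀ v e, t < v → v < u → s v = some e → e.proc ≠ p

theorem completesAt_count_iff {s : ℕ → Option (Event X n)} {t : ℕ} {p : Fin n} {o : Op X}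
    (ht : s t = some (.inv p o)) :
    History.CompletesAt (compact s) (Nat.count (fun t => (s t).isSome = true) t) ↔
      ∃ u a, CompletesBetween s t u p o a := by
  have h0 : (compact s).get? (Nat.count (fun t => (s t).isSome = true) t) =
      some (.inv p o) := compact_get?_eq_some.2 ⟨t, ht, rfl⟩
  constructor
  · rintro ⟨p', o', l, a, hl, h1, h2, hacc, hnone⟩
    rw [h0] at h1
    cases h1
    obtain ⟨u, hu, rfl⟩ := compact_get?_eq_some.1 h2
    refine ⟨u, a, lt_of_count_isSome_lt hl, ht, hu, hacc, ?_⟩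
    intro v e hv hv' he
    exact hnone _ e (count_isSome_lt ht hv) (count_isSome_lt he hv')
      (compact_get?_eq_some.2 ⟨v, he, rfl⟩)
  · rintro ⟨u, a, htu, -, hu, hacc, hnone⟩
    refine ⟨p, o, Nat.count (fun t => (s t).isSome = true) u, a, count_isSome_lt ht htu, h0,
      compact_get?_eq_some.2 ⟨u, hu, rfl⟩, hacc, ?_⟩
    intro m e hm hm' he
    obtain ⟨v, hv, rfl⟩ := compact_get?_eq_some.1 he
    exact hnone v e (lt_of_count_isSome_lt hm) (lt_of_count_isSome_lt hm') hv

end Completion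

/-! ### Linear orders with finite initial segments -/

section Rank

variable {O : Type*} [LinearOrder O]

theorem ncard_Iio_lt (hfin : ∀ x : O, (Set.Iio x).Finite) {x y : O} (h : x < y) :
    (Set.Iio x).ncard < (Set.Iio y).ncard :=
  Set.ncard_lt_ncard (Set.Iio_ssubset_Iio_iff.2 h) (hfin y)

theorem ncard_Iio_lt_iff (hfin : ∀ x : O, (Set.Iio x).Finite) {x y : O} :
    (Set.Iio x).ncard < (Set.Iio y).ncard ↔ x < y := by
  refine ⟨fun h => ?_, ncard_Iio_lt hfin⟩
  by_contra hle
  rcases (not_lt.1 hle).eq_or_lt with rfl | h'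
  · exact lt_irrefl _ h
  · exact (ncard_Iio_lt hfin h').not_gt h

theorem ncard_Iio_injective (hfin : ∀ x : O, (Set.Iio x).Finite) :
    Function.Injective fun x : O => (Set.Iio x).ncard := by
  intro x y h
  rcases lt_trichotomy x y with hlt | hlt | hlt
  · exact absurd h (ncard_Iio_lt hfin hlt).ne
  · exact hlt
  · exact absurd h (ncard_Iio_lt hfin hlt).ne'

/-- The elements below `x` have distinct ranks below that of `x`, and there are as many of them as
such ranks, so no rank is skipped. -/
theorem exists_ncard_Iio_eq (hfin : ∀ x : O, (Set.Iio x).Finite) {x : O} {k : ℕ}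
    (hk : k < (Set.Iio x).ncard) : ∃ y : O, (Set.Iio y).ncard = k := by
  classical
  have hsub : (hfin x).toFinset.image (fun y : O => (Set.Iio y).ncard) ⊆
      Finset.range (Set.Iio x).ncard := by
    intro m hm
    obtain ⟨y, hy, rfl⟩ := Finset.mem_image.1 hm
    exact Finset.mem_range.2 (ncard_Iio_lt hfin (by simpa using hy))
  have heq := Finset.eq_of_subset_of_card_le hsub (by
    rw [Finset.card_image_of_injective _ (ncard_Iio_injective hfin), Finset.card_range,
      Set.ncard_eq_toFinset_card _ (hfin x)])
  have := heq ▸ Finset.mem_range.2 hk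
  obtain ⟨y, -, hy⟩ := Finset.mem_image.1 this
  exact ⟨y, hy⟩

variable {β : Type*}

open Classical in
/-- The sequence `f x₀, g x₀, f x₁, g x₁, …` for an increasing enumeration `x₀, x₁, …`. -/
noncomputable def interleave (f g : O → β) (m : ℕ) : Option β :=
  if h : ∃ x : O, (Set.Iio x).ncard = m / 2 then
    some (if m % 2 = 0 then f h.choose else g h.choose)
  else none

theorem interleave_even (hfin : ∀ x : O, (Set.Iio x).Finite) (f g : O → β) (x : O) :
    interleave f g (2 * (Set.Iio x).ncard) = some (f x) := by
  have h : ∃ y : O, (Set.Iio y).ncard = 2 * (Set.Iio x).ncard / 2 := ⟨x, by omega⟩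
  have hx : h.choose = x := ncard_Iio_injective hfin (h.choose_spec.trans (by simp))
  rw [interleave, dif_pos h, hx, if_pos (by omega)]

theorem interleave_odd (hfin : ∀ x : O, (Set.Iio x).Finite) (f g : O → β) (x : O) :
    interleave f g (2 * (Set.Iio x).ncard + 1) = some (g x) := by
  have h : ∃ y : O, (Set.Iio y).ncard = (2 * (Set.Iio x).ncard + 1) / 2 := ⟨x, by omega⟩
  have hx : h.choose = x :=
    ncard_Iio_injective hfin (h.choose_spec.trans (by show _ = (Set.Iio x).ncard; omega))
  rw [interleave, dif_pos h, hx, if_neg (by omega)]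

theorem interleave_eq_some {f g : O → β} {m : ℕ} {b : β} (h : interleave f g m = some b) :
    ∃ x : O, (m = 2 * (Set.Iio x).ncard ∧ b = f x) ∨
      (m = 2 * (Set.Iio x).ncard + 1 ∧ b = g x) := by
  unfold interleave at h
  split_ifs at h with h' h2
  · refine ⟨h'.choose, Or.inl ⟨?_, by simpa using h.symm⟩⟩
    have := h'.choose_spec
    omega
  · refine ⟨h'.choose, Or.inr ⟨?_, by simpa using h.symm⟩⟩
    have := h'.choose_spec
    omega

theorem interleave_isSeq (hfin : ∀ x : O, (Set.Iio x).Finite) (f g : O → β) :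
    Stream'.IsSeq (interleave f g) := by
  intro m hm
  have hm' : interleave f g m = none := hm
  change interleave f g (m + 1) = none
  by_contra h
  obtain ⟨b, hb⟩ := Option.ne_none_iff_exists'.1 h
  obtain ⟨x, ⟨h1, -⟩ | ⟨h1, -⟩⟩ := interleave_eq_some hb
  -- Position `m + 1` holds the first half of `x`, so `m` holds the second half of the predecessor
  -- of `x`; the rank of `x` is positive because `m + 1` is.
  · obtain ⟨y, hy⟩ := exists_ncard_Iio_eq hfin (x := x) (k := (Set.Iio x).ncard - 1) (by omega)
    have := interleave_odd hfin f g y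
    rw [hy, show 2 * ((Set.Iio x).ncard - 1) + 1 = m by omega, hm'] at this
    cases this
  · have := interleave_even hfin f g x
    rw [show 2 * (Set.Iio x).ncard = m by omega, hm'] at this
    cases this

end Rank

/-! ### Register values in a sequential history -/

section RegValue

variable {X : Type*} {n : ℕ}

theorem regValue_succ_of_not_write (H : History X n) (r : X) (k : ℕ)
    (h : ∀ p v, H.get? k ≠ some (.inv p (.write r v))) :
    History.regValue H r (k + 1) = History.regValue H r k := by
  rw [History.regValue]
  split
  · next h' =>
    rw [if_neg]
    rintro rfl
    exact h _ _ h'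
  · rfl

theorem regValue_eq_zero (H : History X n) (r : X) (k : ℕ)
    (h : ∀ m p v, m < k → H.get? m ≠ some (.inv p (.write r v))) :
    History.regValue H r k = 0 := by
  induction k with
  | zero => rfl
  | succ k ih =>
    rw [regValue_succ_of_not_write _ _ _ fun p v => h k p v (Nat.lt_succ_self k)]
    exact ih fun m p v hm => h m p v (hm.trans (Nat.lt_succ_self k))

theorem regValue_eq_of_write (H : History X n) (r : X) (k j : ℕ) (hj : j < k) (q : Fin n) (w : ℤ)
    (hw : H.get? j = some (.inv q (.write r w)))
    (h : ∀ m p v, j < m → m < k → H.get? m ≠ some (.inv p (.write r v))) :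
    History.regValue H r k = w := by
  induction k with
  | zero => omega
  | succ k ih =>
    rcases (Nat.lt_succ_iff.1 hj).eq_or_lt with rfl | hlt
    · rw [History.regValue, hw]
      simp
    · rw [regValue_succ_of_not_write _ _ _ fun p v => h k p v hlt (Nat.lt_succ_self k)]
      exact ih hlt fun m p v hm hm' => h m p v hm (hm'.trans (Nat.lt_succ_self k))

end RegValue

/-! ### A criterion for sequential consistency -/

section Criterion

variable {X : Type*} {n : ℕ} {O : Type*} [LinearOrder O]

theorem CompletesBetween.res_lt_inv {s : ℕ → Option (Event X n)} {t u v : ℕ} {p : Fin n}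
    {o o' : Op X} {a : Ret} (h : CompletesBetween s t u p o a)
    (hv : s v = some (.inv p o')) (htv : t < v) : u < v := by
  obtain ⟨-, -, hu, -, hnone⟩ := h
  rcases lt_trichotomy u v with h' | rfl | h'
  · exact h'
  · rw [hu] at hv
    cases hv
  · exact absurd rfl (hnone v _ htv h' hv)

/-- A complete history is sequentially consistent if its operations have a linear order of type
at most `ω` that extends the process orders and in which reads return the last written values. -/
theorem sc_of_linearOrder {s : ℕ → Option (Event X n)} (P : O → Fin n) (o : O → Op X)
    (a : O → Ret) (ti tr : O → ℕ)
    (hC : ∀ x, CompletesBetween s (ti x) (tr x) (P x) (o x) (a x))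
    (hcov : ∀ t e, s t = some e → ∃ x, t = ti x ∨ t = tr x)
    (hinj : Function.Injective ti)
    (hord : ∀ x y, P x = P y → ti x < ti y → x < y)
    (hfin : ∀ x : O, (Set.Iio x).Finite)
    (hlegal : ∀ x r v, o x = .read r → a x = .value v →
      (v = 0 ∧ ∀ y w, o y = .write r w → ¬ y < x) ∨
      ∃ y, o y = .write r v ∧ y < x ∧ ∀ z w, o z = .write r w → y < z → ¬ z < x) :
    History.SC (compact s) := by
  set f : O → Event X n := fun x => .inv (P x) (o x) with hf
  set g : O → Event X n := fun x => .res (P x) (a x) with hg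
  let S : History X n := ⟨interleave f g, interleave_isSeq hfin f g⟩
  have hSe : ∀ x, S.get? (2 * (Set.Iio x).ncard) = some (f x) := interleave_even hfin f g
  have hSo : ∀ x, S.get? (2 * (Set.Iio x).ncard + 1) = some (g x) := interleave_odd hfin f g
  have hS : ∀ m e, S.get? m = some e → ∃ x : O, (m = 2 * (Set.Iio x).ncard ∧ e = f x) ∨
      (m = 2 * (Set.Iio x).ncard + 1 ∧ e = g x) := fun m e h => interleave_eq_some h
  have hwr : ∀ m p r v, S.get? m = some (.inv p (.write r v)) →
      ∃ y, m = 2 * (Set.Iio y).ncard ∧ o y = .write r v := by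
    intro m p r v h
    obtain ⟨y, ⟨rfl, h'⟩ | ⟨-, h'⟩⟩ := hS _ _ h
    · simp only [hf, Event.inv.injEq] at h'
      exact ⟨y, rfl, h'.2.symm⟩
    · cases h'
  refine ⟨S, ⟨⟨?_, ?_⟩, ?_⟩, ?_⟩
  · intro k e h
    obtain ⟨x, ⟨-, rfl⟩ | ⟨h', -⟩⟩ := hS _ _ h
    · exact ⟨_, _, rfl⟩
    · omega
  · intro k e h
    obtain ⟨x, ⟨h', -⟩ | ⟨h', rfl⟩⟩ := hS _ _ h
    · omega
    · refine ⟨P x, o x, a x, ?_, rfl, (hC x).2.2.2.1⟩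
      rw [show 2 * k = 2 * (Set.Iio x).ncard by omega]
      exact hSe x
  · intro k p q r v hk hk'
    obtain ⟨x, ⟨rfl, h'⟩ | ⟨-, h'⟩⟩ := hS _ _ hk
    swap
    · cases h'
    rw [hSo x] at hk'
    simp only [hf, hg, Event.inv.injEq, Option.some.injEq, Event.res.injEq] at h' hk'
    rcases hlegal x r v h'.2.symm hk'.2 with ⟨rfl, hno⟩ | ⟨y, hy, hyx, hno⟩
    · refine (regValue_eq_zero _ _ _ ?_).symm
      intro m p v hm hw
      obtain ⟨y, rfl, hy⟩ := hwr _ _ _ _ hw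
      exact hno y v hy ((ncard_Iio_lt_iff hfin).1 (by omega))
    · have := ncard_Iio_lt hfin hyx
      refine (regValue_eq_of_write _ _ _ (2 * (Set.Iio y).ncard) (by omega) (P y) v ?_ ?_).symm
      · rw [hSe y]
        simp only [hf, hy]
      · intro m p w hm hm' hw
        obtain ⟨z, rfl, hz⟩ := hwr _ _ _ _ hw
        exact hno z w hz ((ncard_Iio_lt_iff hfin).1 (by omega))
          ((ncard_Iio_lt_iff hfin).1 (by omega))
  · intro p
    unfold History.proj
    rw [compact_filter_compact]
    -- `φ` sends a position of `S` to the time of the same event in the execution; the default is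
    -- irrelevant, as only positions inside `S` are used.
    let φ : ℕ → ℕ := fun m => (interleave ti tr m).getD 0
    have hφe : ∀ x, φ (2 * (Set.Iio x).ncard) = ti x := fun x => by
      simp only [φ, interleave_even hfin, Option.getD_some]
    have hφo : ∀ x, φ (2 * (Set.Iio x).ncard + 1) = tr x := fun x => by
      simp only [φ, interleave_odd hfin, Option.getD_some]
    have key : ∀ m e, (S.get? m).filter (fun e => decide (e.proc = p)) = some e →
        ∃ x, P x = p ∧ ((m = 2 * (Set.Iio x).ncard ∧ e = f x) ∨
          (m = 2 * (Set.Iio x).ncard + 1 ∧ e = g x)) := by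
      intro m e h
      rw [Option.filter_eq_some_iff, decide_eq_true_eq] at h
      obtain ⟨x, hx⟩ := hS _ _ h.1
      refine ⟨x, ?_, hx⟩
      rw [← h.2]
      rcases hx with ⟨-, rfl⟩ | ⟨-, rfl⟩ <;> rfl
    refine compact_eq_compact_of_strictMonoOn φ ?_ ?_ ?_
    · intro m e h
      obtain ⟨x, hx, ⟨rfl, rfl⟩ | ⟨rfl, rfl⟩⟩ := key m e h
      · rw [hφe, (hC x).2.1, Option.filter_eq_some_iff]
        exact ⟨rfl, decide_eq_true hx⟩
      · rw [hφo, (hC x).2.2.1, Option.filter_eq_some_iff]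
        exact ⟨rfl, decide_eq_true hx⟩
    · intro m m' hm hm' hlt
      obtain ⟨e, he⟩ := Option.isSome_iff_exists.1 hm
      obtain ⟨e', he'⟩ := Option.isSome_iff_exists.1 hm'
      obtain ⟨x, hx, hxm⟩ := key m e he
      obtain ⟨y, hy, hym⟩ := key m' e' he'
      have hle : x ≤ y := by
        by_contra hyx
        have := ncard_Iio_lt hfin (not_le.1 hyx)
        omega
      rcases hle.eq_or_lt with rfl | hxy
      · obtain ⟨rfl, -⟩ : m = 2 * (Set.Iio x).ncard ∧ _ := hxm.resolve_right (by omega)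
        obtain ⟨rfl, -⟩ : m' = 2 * (Set.Iio x).ncard + 1 ∧ _ := hym.resolve_left (by omega)
        rw [hφe, hφo]
        exact (hC x).1
      -- Operations of one process are ranked by invocation time, and each responds before the next
      -- is invoked.
      · have hti : ti x < ti y := by
          by_contra hle
          rcases (not_lt.1 hle).eq_or_lt with h | h
          · exact hxy.ne' (hinj h)
          · exact hxy.not_gt (hord y x (hy.trans hx.symm) h)
        have h1 : tr x < ti y := (hC x).res_lt_inv (o' := o y)
          (by rw [(hC y).2.1, hx, hy]) hti
        have h2 := (hC x).1
        have h3 := (hC y).1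
        rcases hxm with ⟨rfl, -⟩ | ⟨rfl, -⟩ <;> rcases hym with ⟨rfl, -⟩ | ⟨rfl, -⟩ <;>
          simp only [hφe, hφo] <;> omega
    · intro t ht
      obtain ⟨e, he⟩ := Option.isSome_iff_exists.1 ht
      rw [Option.filter_eq_some_iff, decide_eq_true_eq] at he
      obtain ⟨he, hep⟩ := he
      obtain ⟨x, rfl | rfl⟩ := hcov t e he
      · rw [(hC x).2.1] at he
        cases he
        refine ⟨_, ?_, hφe x⟩
        rw [Option.isSome_iff_exists]
        refine ⟨f x, ?_⟩
        rw [Option.filter_eq_some_iff]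
        exact ⟨hSe x, decide_eq_true hep⟩
      · rw [(hC x).2.2.1] at he
        cases he
        refine ⟨_, ?_, hφo x⟩
        rw [Option.isSome_iff_exists]
        refine ⟨g x, ?_⟩
        rw [Option.filter_eq_some_iff]
        exact ⟨hSo x, decide_eq_true hep⟩

end Criterion

/-! ### Packets and request slots -/

section Packets

variable {X : Type*} {n : ℕ}

/-- The logical time in a timestamp-value pair. -/
def tsvTime (τ : TSV) : ℕ := (ofLex (ofLex τ).1).1

/-- The initial timestamp-value pair. -/
def initTSV : TSV := toLex (toLex (0, 0), 0)

/-- The timestamp-value pair of a write of `v` invoked by process `i` at logical time `l`. -/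
def writeTSV (l : ℕ) (i : Fin n) (v : ℤ) : TSV := toLex (toLex (l, pid i), v)

/-- The request identifier in a message. -/
def Msg.rid : Msg X → ℕ
  | .query _ rid _ => rid
  | .response _ rid _ => rid
  | .update _ rid _ _ => rid
  | .ack _ rid => rid

/-- Queries and updates are requests. -/
def Msg.IsRequest : Msg X → Prop
  | .query _ _ _ => True
  | .response _ _ _ => False
  | .update _ _ _ _ => True
  | .ack _ _ => False

/-- The process whose operation a message belongs to. -/
def Packet.client : Packet X n → Fin n
  | ⟨i, _, .query _ _ _⟩ => i
  | ⟨_, i, .response _ _ _⟩ => i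
  | ⟨i, _, .update _ _ _ _⟩ => i
  | ⟨_, i, .ack _ _⟩ => i

/-- The process that answers, or has answered, a request. -/
def Packet.server : Packet X n → Fin n
  | ⟨_, j, .query _ _ _⟩ => j
  | ⟨j, _, .response _ _ _⟩ => j
  | ⟨_, j, .update _ _ _ _⟩ => j
  | ⟨j, _, .ack _ _⟩ => j

/-- The packet is the request `rid` of process `i` to process `j` or an answer to it. -/
def Packet.InSlot (i j : Fin n) (rid : ℕ) (m : Packet X n) : Prop :=
  m.client = i ∧ m.server = j ∧ m.msg.rid = rid

theorem client_of_isRequest {i j : Fin n} {M : Msg X} (h : M.IsRequest) :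
    (Packet.mk i j M).client = i := by
  cases M <;> first | rfl | exact h.elim

theorem server_of_isRequest {i j : Fin n} {M : Msg X} (h : M.IsRequest) :
    (Packet.mk i j M).server = j := by
  cases M <;> first | rfl | exact h.elim

instance (i j : Fin n) (rid : ℕ) : DecidablePred (Packet.InSlot (X := X) i j rid) := fun m =>
  inferInstanceAs (Decidable (m.client = i ∧ m.server = j ∧ m.msg.rid = rid))

/-- The number of packets that are the request `rid` of `i` to `j` or an answer to it. -/
def slotCount (i j : Fin n) (rid : ℕ) (T : Multiset (Packet X n)) : ℕ :=
  T.countP (Packet.InSlot i j rid)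

theorem slotCount_add (i j : Fin n) (ρ : ℕ) (S T : Multiset (Packet X n)) :
    slotCount i j ρ (S + T) = slotCount i j ρ S + slotCount i j ρ T :=
  Multiset.countP_add _ _ _

theorem slotCount_cons_of_inSlot {i j : Fin n} {ρ : ℕ} {m : Packet X n} (h : m.InSlot i j ρ)
    (T : Multiset (Packet X n)) : slotCount i j ρ (m ::ₘ T) = slotCount i j ρ T + 1 :=
  Multiset.countP_cons_of_pos _ h

theorem slotCount_cons_of_not_inSlot {i j : Fin n} {ρ : ℕ} {m : Packet X n}
    (h : ¬ m.InSlot i j ρ) (T : Multiset (Packet X n)) :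
    slotCount i j ρ (m ::ₘ T) = slotCount i j ρ T :=
  Multiset.countP_cons_of_neg _ h

theorem slotCount_eq_zero {i j : Fin n} {ρ : ℕ} {T : Multiset (Packet X n)}
    (h : ∀ m ∈ T, ¬ m.InSlot i j ρ) : slotCount i j ρ T = 0 :=
  Multiset.countP_eq_zero.2 h

theorem exists_inSlot_of_slotCount_pos {i j : Fin n} {ρ : ℕ} {T : Multiset (Packet X n)}
    (h : 0 < slotCount i j ρ T) : ∃ m ∈ T, m.InSlot i j ρ :=
  Multiset.countP_pos.1 h

theorem slotCount_pos {i j : Fin n} {ρ : ℕ} {T : Multiset (Packet X n)} {m : Packet X n}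
    (hm : m ∈ T) (h : m.InSlot i j ρ) : 0 < slotCount i j ρ T :=
  Multiset.countP_pos.2 ⟨m, hm, h⟩

theorem mem_bcast {i : Fin n} {M : Msg X} {m : Packet X n} :
    m ∈ bcast i M ↔ ∃ j, m = ⟨i, j, M⟩ := by
  simp [bcast, eq_comm]

theorem slotCount_bcast {i j : Fin n} {M : Msg X} (h : M.IsRequest) :
    slotCount i j M.rid (bcast i M) = 1 := by
  unfold slotCount bcast
  rw [Multiset.countP_map]
  have : ∀ k : Fin n, Packet.InSlot i j M.rid ⟨i, k, M⟩ ↔ k = j := fun k => by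
    simp [Packet.InSlot, client_of_isRequest h, server_of_isRequest h]
  simp only [this]
  rw [← Finset.filter_val, Finset.card_val, Finset.filter_eq']
  simp

end Packets

/-! ### Assertions about clocks and stored pairs -/

section Facts

variable {X : Type*} {n : ℕ} (E : Execution X n)

/-- The logical time of process `i` at time `t`. -/
def Execution.clock (t : ℕ) (i : Fin n) : ℕ := ((E.config t).procs i).lt

/-- The timestamp-value pair that process `i` stores for register `r` at time `t`. -/
def Execution.stored (t : ℕ) (i : Fin n) (r : X) : TSV := ((E.config t).procs i).tvps r

/-- The pair is the initial one or that of a write to `r`. -/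
def Execution.Known (r : X) (τ : TSV) : Prop :=
  τ = initTSV ∨ ∃ t i v, E.event t = some (.inv i (.write r v)) ∧
    τ = writeTSV (E.clock (t + 1) i) i v

/-- At some time when its clock is greater than `l`, process `j` stores at most `τ` for `r`. -/
def Execution.Sampled (l : ℕ) (j : Fin n) (r : X) (τ : TSV) : Prop :=
  ∃ u, l < E.clock u j ∧ E.stored u j r ≤ τ

/-- At some time when its clock is at most `l`, process `j` stores at least `τ` for `r`. -/
def Execution.Secured (l : ℕ) (j : Fin n) (r : X) (τ : TSV) : Prop :=
  ∃ u, E.clock u j ≤ l ∧ τ ≤ E.stored u j r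

theorem Execution.Secured.mono {E : Execution X n} {l l' : ℕ} {j : Fin n} {r : X} {τ : TSV}
    (h : E.Secured l j r τ) (hl : l ≤ l') : E.Secured l' j r τ := by
  obtain ⟨u, hu, hu'⟩ := h
  exact ⟨u, hu.trans hl, hu'⟩

/-- The operation `o` invoked by `i` at time `t₀` is the last event of `i` before time `t`. -/
def Execution.Pending (t₀ : ℕ) (i : Fin n) (o : Op X) (t : ℕ) : Prop :=
  t₀ < t ∧ E.event t₀ = some (.inv i o) ∧
    ∀ u e, t₀ < u → u < t → E.event u = some e → e.proc ≠ i

theorem Execution.Pending.succ {E : Execution X n} {t₀ t : ℕ} {i : Fin n} {o : Op X}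
    (h : E.Pending t₀ i o t) (he : ∀ e, E.event t = some e → e.proc ≠ i) :
    E.Pending t₀ i o (t + 1) := by
  refine ⟨h.1.trans (Nat.lt_succ_self t), h.2.1, fun u e hu hu' hue => ?_⟩
  rcases (Nat.lt_succ_iff.1 hu').eq_or_lt with rfl | hlt
  · exact he e hue
  · exact h.2.2 u e hu hlt hue

end Facts

/-! ### The invariant -/

section Invariant

variable {X : Type*} {n : ℕ} (E : Execution X n)

/-- The phases of a process as a client, with the time when its operation was invoked, its register,
and the timestamp-value pair of its update. -/
inductive Phase (X : Type*) where
  | idle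
  | query (t₀ : ℕ) (r : X)
  | update (t₀ : ℕ) (r : X) (τ : TSV)

/-- What a message to or from the client `i` with current request identifier `ρ` says. -/
def PacketOK (i : Fin n) (ρ : ℕ) (g : Phase X) : Packet X n → Prop
  | ⟨_, _, .query l rid r⟩ => rid ≤ ρ ∧
      (rid = ρ → ∃ t₀, g = .query t₀ r ∧ E.clock (t₀ + 1) i ≤ l)
  | ⟨j, _, .response l rid τ⟩ => rid ≤ ρ ∧ tsvTime τ ≤ l ∧
      (rid = ρ → ∃ t₀ r, g = .query t₀ r ∧ E.Known r τ ∧ E.Sampled (E.clock (t₀ + 1) i) j r τ)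
  | ⟨_, _, .update l rid r τ⟩ => rid ≤ ρ ∧ tsvTime τ ≤ l ∧ E.Known r τ ∧
      (rid = ρ → ∃ t₀, g = .update t₀ r τ)
  | ⟨j, _, .ack l rid⟩ => rid ≤ ρ ∧
      (rid = ρ → ∃ t₀ r τ, g = .update t₀ r τ ∧ E.Secured l j r τ)

variable {E} in
theorem PacketOK.rid_le {i : Fin n} {ρ : ℕ} {g : Phase X} {m : Packet X n}
    (h : PacketOK E i ρ g m) : m.msg.rid ≤ ρ := by
  obtain ⟨a, b, M⟩ := m
  cases M <;> exact h.1

variable {E} in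
theorem PacketOK.succ {i : Fin n} {ρ : ℕ} {g g' : Phase X} {m : Packet X n}
    (h : PacketOK E i ρ g m) : PacketOK E i (ρ + 1) g' m := by
  have hr := h.rid_le
  obtain ⟨a, b, M⟩ := m
  cases M <;> simp only [PacketOK, Msg.rid] at h hr ⊢
  · exact ⟨by omega, fun h => by omega⟩
  · exact ⟨by omega, h.2.1, fun h => by omega⟩
  · exact ⟨by omega, h.2.1, h.2.2.1, fun h => by omega⟩
  · exact ⟨by omega, fun h => by omega⟩

/-- The messages in transit of the client `i`: there is one message in transit for each process
that has not been heard from. -/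
structure NetOK (i : Fin n) (ρ : ℕ) (g : Phase X) (R : Finset (Fin n))
    (T : Multiset (Packet X n)) : Prop where
  packets : ∀ m ∈ T, m.client = i → PacketOK E i ρ g m
  slots : g ≠ .idle → ∀ j, slotCount i j ρ T + (if j ∈ R then 1 else 0) = 1

namespace NetOK

variable {E} {i : Fin n} {ρ : ℕ} {g : Phase X} {R : Finset (Fin n)} {T T' : Multiset (Packet X n)}

theorem replace (h : NetOK E i ρ g R T)
    (hp : ∀ m ∈ T', m.client = i → m ∈ T ∨ PacketOK E i ρ g m)
    (hc : ∀ j, slotCount i j ρ T' = slotCount i j ρ T) : NetOK E i ρ g R T' where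
  packets m hm hi := (hp m hm hi).elim (fun h' => h.packets m h' hi) id
  slots hg j := by rw [hc]; exact h.slots hg j

/-- Packets already in transit have identifiers at most `ρ`, so they become stale, and the broadcast
puts exactly one packet into each new slot. -/
theorem broadcast (h : NetOK E i ρ g R T) {g' : Phase X} {M : Msg X} (hM : M.IsRequest)
    (hrid : M.rid = ρ + 1) (hT : ∀ m ∈ T', m ∈ T)
    (hp : ∀ j, PacketOK E i (ρ + 1) g' ⟨i, j, M⟩) :
    NetOK E i (ρ + 1) g' ∅ (T' + bcast i M) where
  packets m hm hi := by
    rcases Multiset.mem_add.1 hm with hm | hm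
    · exact (h.packets m (hT m hm) hi).succ
    · obtain ⟨j, rfl⟩ := mem_bcast.1 hm
      exact hp j
  slots _ j := by
    rw [slotCount_add, ← hrid, slotCount_bcast hM, slotCount_eq_zero]
    · simp
    · rintro m hm ⟨hi, -, hr⟩
      have := (h.packets m (hT m hm) hi).rid_le
      omega

theorem finish (h : NetOK E i ρ g R T) (R' : Finset (Fin n)) (hT : ∀ m ∈ T', m ∈ T) :
    NetOK E i (ρ + 1) .idle R' T' where
  packets m hm hi := (h.packets m (hT m hm) hi).succ
  slots hg := absurd rfl hg

/-- This excludes two answers by the same process to one request. -/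
theorem not_mem_of_inSlot (h : NetOK E i ρ g R T) (hg : g ≠ .idle) {m : Packet X n} {j : Fin n}
    (hm : m ∈ T) (hs : m.InSlot i j ρ) : j ∉ R := by
  intro hj
  have h1 := h.slots hg j
  have h2 := slotCount_pos hm hs
  rw [if_pos hj] at h1
  omega

/-- Receiving the answer moves the single unit of `j` from the network to the set of responders. -/
theorem hear {m : Packet X n} (h : NetOK E i ρ g R (m ::ₘ T)) (hg : g ≠ .idle) {j : Fin n}
    (hs : m.InSlot i j ρ) {R' : Finset (Fin n)} (hR : ∀ k, k ∈ R' ↔ k = j ∨ k ∈ R) :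
    NetOK E i ρ g R' T where
  packets m' hm' := h.packets m' (Multiset.mem_cons_of_mem hm')
  slots _ k := by
    have h1 := h.slots hg k
    by_cases hk : k = j
    · subst hk
      rw [slotCount_cons_of_inSlot hs] at h1
      rw [if_pos ((hR k).2 (Or.inl rfl))]
      have := h.not_mem_of_inSlot hg (Multiset.mem_cons_self m T) hs
      rw [if_neg this] at h1
      omega
    · rw [slotCount_cons_of_not_inSlot fun h => hk (h.2.1.symm.trans hs.2.1)] at h1
      simpa [hR, hk] using h1

end NetOK

/-- The processes from which the client has heard in the current phase. -/
def ProcState.responders (s : ProcState X n) : Finset (Fin n) :=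
  s.responses.image (fun x => (ofLex x).2) ∪ s.acks

/-- The state of a client in the query phase of a read. -/
structure QueryState (t : ℕ) (i : Fin n) (t₀ : ℕ) (r : X) (s : ProcState X n) : Prop where
  pending : E.Pending t₀ i (.read r) t
  rid : s.rid = ((E.config (t₀ + 1)).procs i).rid
  clock : E.clock (t₀ + 1) i ≤ s.lt
  reading : s.reading = true
  rreg : s.rreg = r
  acks : s.acks = ∅
  card_lt : s.responses.card < quorum n
  card_image : (s.responses.image fun x => (ofLex x).2).card = s.responses.card
  sampled : ∀ x ∈ s.responses, E.Known r (ofLex x).1 ∧ tsvTime (ofLex x).1 ≤ s.lt ∧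
    E.Sampled (E.clock (t₀ + 1) i) (ofLex x).2 r (ofLex x).1

/-- What holds of the pair `τ` in the update phase of an operation. -/
def OpState (i : Fin n) (t₀ : ℕ) (r : X) (τ : TSV) (s : ProcState X n) : Op X → Prop
  | .read r' => r' = r ∧ s.rid = ((E.config (t₀ + 1)).procs i).rid + 1 ∧ s.reading = true ∧
      s.rval = (ofLex τ).2 ∧ ∃ Q : Finset (Fin n), Q.card = quorum n ∧
        ∀ j ∈ Q, E.Sampled (E.clock (t₀ + 1) i) j r τ
  | .write r' v => r' = r ∧ s.rid = ((E.config (t₀ + 1)).procs i).rid ∧ s.reading = false ∧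
      τ = writeTSV (E.clock (t₀ + 1) i) i v

/-- The state of a client in the update phase of an operation. -/
structure UpdateState (t : ℕ) (i : Fin n) (t₀ : ℕ) (r : X) (τ : TSV) (o : Op X)
    (s : ProcState X n) : Prop where
  pending : E.Pending t₀ i o t
  clock : E.clock (t₀ + 1) i ≤ s.lt
  known : E.Known r τ
  time_le : tsvTime τ ≤ s.lt
  responses : s.responses = ∅
  card_lt : s.acks.card < quorum n
  secured : ∀ j ∈ s.acks, E.Secured s.lt j r τ
  op : OpState E i t₀ r τ s o

/-- The state of a client in phase `g`. -/
def ClientState (t : ℕ) (i : Fin n) (s : ProcState X n) : Phase X → Prop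
  | .idle => s.responses = ∅ ∧ s.acks = ∅
  | .query t₀ r => QueryState E t i t₀ r s
  | .update t₀ r τ => ∃ o, UpdateState E t i t₀ r τ o s

/-- `s'` differs from `s` at most in `tvps` and in a larger clock. -/
def SameClient (s s' : ProcState X n) : Prop :=
  s'.rid = s.rid ∧ s'.responses = s.responses ∧ s'.acks = s.acks ∧ s'.reading = s.reading ∧
    s'.rreg = s.rreg ∧ s'.rval = s.rval ∧ s.lt ≤ s'.lt

theorem SameClient.refl (s : ProcState X n) : SameClient s s :=
  ⟨rfl, rfl, rfl, rfl, rfl, rfl, le_rfl⟩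

theorem SameClient.responders {s s' : ProcState X n} (h : SameClient s s') :
    s'.responders = s.responders := by
  simp only [ProcState.responders, h.2.1, h.2.2.1]

variable {E} in
theorem ClientState.sameClient {t : ℕ} {i : Fin n} {s s' : ProcState X n} {g : Phase X}
    (h : ClientState E t i s g) (hs : SameClient s s')
    (he : ∀ e, E.event t = some e → e.proc ≠ i) : ClientState E (t + 1) i s' g := by
  obtain ⟨h1, h2, h3, h4, h5, h6, h7⟩ := hs
  cases g with
  | idle => exact ⟨h2.trans h.1, h3.trans h.2⟩
  | query t₀ r =>
    change QueryState E t i t₀ r s at h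
    change QueryState E (t + 1) i t₀ r s'
    exact
      { pending := h.pending.succ he
        rid := h1.trans h.rid
        clock := h.clock.trans h7
        reading := h4.trans h.reading
        rreg := h5.trans h.rreg
        acks := h3.trans h.acks
        card_lt := h2 ▸ h.card_lt
        card_image := by rw [h2]; exact h.card_image
        sampled := fun x hx => by
          obtain ⟨ha, hb, hc⟩ := h.sampled x (h2 ▸ hx)
          exact ⟨ha, hb.trans h7, hc⟩ }
  | update t₀ r τ =>
    obtain ⟨o, h⟩ := h
    refine ⟨o, ?_⟩
    exact
      { pending := h.pending.succ he
        clock := h.clock.trans h7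
        known := h.known
        time_le := h.time_le.trans h7
        responses := h2.trans h.responses
        card_lt := h3 ▸ h.card_lt
        secured := fun j hj => (h.secured j (h3 ▸ hj)).mono h7
        op := by
          have := h.op
          cases o <;> simpa only [OpState, h1, h4, h6] using this }

/-- The invariant for the client `i` in phase `g`. -/
structure ClientInv (t : ℕ) (i : Fin n) (g : Phase X) : Prop where
  busy : i ∈ (E.config t).busy ↔ g ≠ .idle
  state : ClientState E t i ((E.config t).procs i) g
  net : NetOK E i ((E.config t).procs i).rid g ((E.config t).procs i).responders
    (E.config t).transit

variable {E} in
-- This covers every step in which `i` does not act as a client, including those in which it acts as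
-- a server.
theorem ClientInv.quiet {t : ℕ} {i : Fin n} {g : Phase X} (h : ClientInv E t i g)
    (hs : SameClient ((E.config t).procs i) ((E.config (t + 1)).procs i))
    (hb : i ∈ (E.config (t + 1)).busy ↔ i ∈ (E.config t).busy)
    (he : ∀ e, E.event t = some e → e.proc ≠ i)
    (hp : ∀ m ∈ (E.config (t + 1)).transit, m.client = i →
      m ∈ (E.config t).transit ∨ PacketOK E i ((E.config t).procs i).rid g m)
    (hc : ∀ j, slotCount i j ((E.config t).procs i).rid (E.config (t + 1)).transit =
      slotCount i j ((E.config t).procs i).rid (E.config t).transit) :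
    ClientInv E (t + 1) i g where
  busy := hb.trans h.busy
  state := h.state.sameClient hs he
  net := by
    rw [hs.1, hs.responders]
    exact h.net.replace hp hc

/-- What holds of the pairs that a process stores. -/
def ServerState (s : ProcState X n) : Prop :=
  ∀ r, E.Known r (s.tvps r) ∧ tsvTime (s.tvps r) ≤ s.lt

variable {E} in
theorem ServerState.mono {s s' : ProcState X n} (h : ServerState E s) (ht : s'.tvps = s.tvps)
    (hl : s.lt ≤ s'.lt) : ServerState E s' := fun r => by
  rw [ht]
  exact ⟨(h r).1, (h r).2.trans hl⟩

/-- The invariant of the algorithm. -/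
structure Invariant (t : ℕ) : Prop where
  server : ∀ j, ServerState E ((E.config t).procs j)
  client : ∀ i, ∃ g, ClientInv E t i g

theorem invariant_zero : Invariant E 0 := by
  obtain ⟨h1, h2, h3, -⟩ := E.initial
  refine ⟨fun j r => ?_, fun i => ⟨.idle, ?_, ?_, ?_, ?_⟩⟩
  · rw [(h1 j).2.2.1 r]
    exact ⟨Or.inl rfl, Nat.zero_le _⟩
  · simp [h3]
  · exact (h1 i).2.2.2
  · simp [h2]
  · simp

end Invariant

/-! ### Case analysis of steps, and monotonicity -/

section Transitions

variable {X : Type*} {n : ℕ}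

/-- Inversion in the form of equations, suited to configurations such as `E.config t`; idle steps
and crashes are merged, since the invariant does not mention crashes. -/
theorem Trans.elim_cases {c c' : Config X n} {s : Step X n} {ev : Option (Event X n)}
    (h : Trans c s ev c') :
    (c'.procs = c.procs ∧ c'.transit = c.transit ∧ c'.busy = c.busy ∧ ev = none ∧
      ∀ m, s ≠ .receive m) ∨
    (∃ i o, i ∉ c.busy ∧ ev = some (.inv i o) ∧
      c'.procs = Function.update c.procs i (onInvoke i (c.procs i) o).state ∧
      c'.transit = c.transit + (onInvoke i (c.procs i) o).sends ∧
      c'.busy = insert i c.busy ∧ ∀ m, s ≠ .receive m) ∨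
    (∃ j k M rest, s = .receive ⟨j, k, M⟩ ∧ c.transit = ⟨j, k, M⟩ ::ₘ rest ∧
      ev = (onReceive k (c.procs k) j M).ret.map (Event.res k) ∧
      c'.procs = Function.update c.procs k (onReceive k (c.procs k) j M).state ∧
      c'.transit = rest + (onReceive k (c.procs k) j M).sends ∧
      c'.busy = if (onReceive k (c.procs k) j M).ret.isSome then c.busy.erase k
        else c.busy) := by
  cases h with
  | idle => exact Or.inl ⟨rfl, rfl, rfl, rfl, fun _ => by simp⟩
  | crash i hi => exact Or.inl ⟨rfl, rfl, rfl, rfl, fun _ => by simp⟩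
  | invoke i o hi hb =>
    exact Or.inr (Or.inl ⟨i, o, hb, rfl, rfl, rfl, rfl, fun _ => by simp⟩)
  | receive m rest hm hi =>
    exact Or.inr (Or.inr ⟨m.src, m.dst, m.msg, rest, rfl, hm, rfl, rfl, rfl, rfl⟩)

theorem onReceive_response_stale (i : Fin n) (s : ProcState X n) (j : Fin n) (l rid : ℕ) (τ : TSV)
    (h : s.rid ≠ rid) :
    onReceive i s j (.response l rid τ) = { state := s, sends := 0, ret := none } := by
  simp only [onReceive, if_neg h]

theorem onReceive_response_insert (i : Fin n) (s : ProcState X n) (j : Fin n) (l rid : ℕ) (τ : TSV)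
    (h : s.rid = rid) (hq : (insert (toLex (τ, j)) s.responses).card ≠ quorum n) :
    onReceive i s j (.response l rid τ) =
      { state := { s with
          lt := max s.lt l + 1
          responses := insert (toLex (τ, j)) s.responses }
        sends := 0, ret := none } := by
  simp only [onReceive, if_pos h, if_neg hq]

/-- The maximum is described by its order property alone, which is all that the invariant needs. -/
theorem onReceive_response_quorum (i : Fin n) (s : ProcState X n) (j : Fin n) (l rid : ℕ) (τ : TSV)
    (h : s.rid = rid) (hq : (insert (toLex (τ, j)) s.responses).card = quorum n) :
    ∃ x ∈ insert (toLex (τ, j)) s.responses,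
      (∀ y ∈ insert (toLex (τ, j)) s.responses, y ≤ x) ∧
      onReceive i s j (.response l rid τ) =
        { state := { s with
            lt := max s.lt l + 1
            rval := (ofLex (ofLex x).1).2
            responses := ∅
            rid := s.rid + 1 }
          sends := bcast i (.update (max s.lt l + 1) (s.rid + 1) s.rreg (ofLex x).1)
          ret := none } := by
  refine ⟨_, Finset.max'_mem _ (Finset.insert_nonempty _ _),
    fun y hy => Finset.le_max' _ y hy, ?_⟩
  simp only [onReceive, if_pos h, if_pos hq]

theorem onReceive_ack_stale (i : Fin n) (s : ProcState X n) (j : Fin n) (l rid : ℕ)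
    (h : s.rid ≠ rid) :
    onReceive i s j (.ack l rid) = { state := s, sends := 0, ret := none } := by
  simp only [onReceive, if_neg h]

theorem onReceive_ack_insert (i : Fin n) (s : ProcState X n) (j : Fin n) (l rid : ℕ)
    (h : s.rid = rid) (hq : (insert j s.acks).card ≠ quorum n) :
    onReceive i s j (.ack l rid) =
      { state := { s with lt := max s.lt l + 1, acks := insert j s.acks }
        sends := 0, ret := none } := by
  simp only [onReceive, if_pos h, if_neg hq]

theorem onReceive_ack_quorum (i : Fin n) (s : ProcState X n) (j : Fin n) (l rid : ℕ)
    (h : s.rid = rid) (hq : (insert j s.acks).card = quorum n) :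
    onReceive i s j (.ack l rid) =
      { state := { s with lt := max s.lt l + 1, acks := ∅, rid := s.rid + 1 }
        sends := 0, ret := some (if s.reading then Ret.value s.rval else Ret.ok) } := by
  simp only [onReceive, if_pos h, if_pos hq]

theorem onInvoke_mono (i : Fin n) (s : ProcState X n) (o : Op X) :
    s.lt < (onInvoke i s o).state.lt ∧ (onInvoke i s o).state.tvps = s.tvps ∧
      (onInvoke i s o).state.rid = s.rid + 1 := by
  cases o <;> simp [onInvoke]

theorem onReceive_mono (i : Fin n) (s : ProcState X n) (j : Fin n) (M : Msg X) :
    s.lt ≤ (onReceive i s j M).state.lt ∧ (∀ r, s.tvps r ≤ (onReceive i s j M).state.tvps r) ∧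
      s.rid ≤ (onReceive i s j M).state.rid := by
  have hl : ∀ l, s.lt ≤ max s.lt l + 1 := fun l => by omega
  cases M with
  | query l rid r => exact ⟨hl l, fun _ => le_rfl, le_rfl⟩
  | response l rid τ =>
    by_cases h : s.rid = rid
    · by_cases hq : (insert (toLex (τ, j)) s.responses).card = quorum n
      · obtain ⟨x, -, -, hx⟩ := onReceive_response_quorum i s j l rid τ h hq
        rw [hx]
        exact ⟨hl l, fun _ => le_rfl, Nat.le_succ _⟩
      · rw [onReceive_response_insert i s j l rid τ h hq]
        exact ⟨hl l, fun _ => le_rfl, le_rfl⟩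
    · rw [onReceive_response_stale i s j l rid τ h]
      exact ⟨le_rfl, fun _ => le_rfl, le_rfl⟩
  | update l rid r τ =>
    refine ⟨hl l, fun r' => ?_, le_rfl⟩
    simp only [onReceive, Function.update_apply]
    split_ifs with h
    · subst h
      exact le_max_left _ _
    · exact le_rfl
  | ack l rid =>
    by_cases h : s.rid = rid
    · by_cases hq : (insert j s.acks).card = quorum n
      · rw [onReceive_ack_quorum i s j l rid h hq]
        exact ⟨hl l, fun _ => le_rfl, Nat.le_succ _⟩
      · rw [onReceive_ack_insert i s j l rid h hq]
        exact ⟨hl l, fun _ => le_rfl, le_rfl⟩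
    · rw [onReceive_ack_stale i s j l rid h]
      exact ⟨le_rfl, fun _ => le_rfl, le_rfl⟩

variable (E : Execution X n)

theorem Execution.step_mono (t : ℕ) (i : Fin n) :
    E.clock t i ≤ E.clock (t + 1) i ∧ (∀ r, E.stored t i r ≤ E.stored (t + 1) i r) ∧
      ((E.config t).procs i).rid ≤ ((E.config (t + 1)).procs i).rid := by
  unfold Execution.clock Execution.stored
  rcases (E.trans t).elim_cases with ⟨hp, -⟩ | ⟨k, o, -, -, hp, -⟩ | ⟨j, k, M, rest, -, -, -, hp, -⟩
  · simp [hp]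
  · rw [hp]
    rcases eq_or_ne i k with rfl | hik
    · obtain ⟨h1, h2, h3⟩ := onInvoke_mono i ((E.config t).procs i) o
      rw [Function.update_self, h2, h3]
      exact ⟨h1.le, fun _ => le_rfl, Nat.le_succ _⟩
    · simp [Function.update_of_ne hik]
  · rw [hp]
    rcases eq_or_ne i k with rfl | hik
    · rw [Function.update_self]
      exact onReceive_mono i _ j M
    · simp [Function.update_of_ne hik]

theorem Execution.clock_mono (i : Fin n) : Monotone fun t => E.clock t i :=
  monotone_nat_of_le_succ fun t => (E.step_mono t i).1

theorem Execution.stored_mono (i : Fin n) (r : X) : Monotone fun t => E.stored t i r :=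
  monotone_nat_of_le_succ fun t => (E.step_mono t i).2.1 r

theorem Execution.rid_mono (i : Fin n) : Monotone fun t => ((E.config t).procs i).rid :=
  monotone_nat_of_le_succ fun t => (E.step_mono t i).2.2

end Transitions

/-! ### Preservation for clients not acting in a step -/

section Preservation

variable {X : Type*} {n : ℕ} {E : Execution X n} {t : ℕ}

theorem bcast_client {i : Fin n} {M : Msg X} (hM : M.IsRequest) {m : Packet X n}
    (hm : m ∈ bcast i M) : m.client = i := by
  obtain ⟨j, rfl⟩ := mem_bcast.1 hm
  exact client_of_isRequest hM

/-- A step in which process `k` handles only its own messages does not affect other clients. -/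
theorem ClientInv.of_other {i k : Fin n} {g : Phase X} (h : ClientInv E t i g) (hik : i ≠ k)
    {s : ProcState X n} {T rest S : Multiset (Packet X n)}
    (hp : (E.config (t + 1)).procs = Function.update (E.config t).procs k s)
    (hb : i ∈ (E.config (t + 1)).busy ↔ i ∈ (E.config t).busy)
    (he : ∀ e, E.event t = some e → e.proc = k)
    (hT : (E.config t).transit = T + rest) (hT' : (E.config (t + 1)).transit = rest + S)
    (hTk : ∀ m ∈ T, m.client = k) (hSk : ∀ m ∈ S, m.client = k) :
    ClientInv E (t + 1) i g := by
  refine h.quiet ?_ hb (fun e h' hei => hik (hei.symm.trans (he e h'))) ?_ ?_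
  · rw [hp, Function.update_of_ne hik]
    exact SameClient.refl _
  · intro m hm hi
    rw [hT'] at hm
    rcases Multiset.mem_add.1 hm with hm | hm
    · exact Or.inl (hT ▸ Multiset.mem_add.2 (Or.inr hm))
    · exact absurd (hi.symm.trans (hSk m hm)) hik
  · intro j
    rw [hT, hT', slotCount_add, slotCount_add,
      slotCount_eq_zero fun m hm h' => hik (h'.1.symm.trans (hSk m hm)),
      slotCount_eq_zero fun m hm h' => hik (h'.1.symm.trans (hTk m hm))]
    omega

/-- When a process answers a request, the invariant of its client is preserved. -/
theorem ClientInv.of_answer {i k : Fin n} {g : Phase X} (h : ClientInv E t i g)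
    {s : ProcState X n} {rest : Multiset (Packet X n)} {m m' : Packet X n}
    (hp : (E.config (t + 1)).procs = Function.update (E.config t).procs k s)
    (hs : SameClient ((E.config t).procs k) s)
    (hb : (E.config (t + 1)).busy = (E.config t).busy)
    (he : E.event t = none)
    (hT : (E.config t).transit = m ::ₘ rest) (hT' : (E.config (t + 1)).transit = rest + {m'})
    (hc : m'.client = m.client) (hv : m'.server = m.server) (hr : m'.msg.rid = m.msg.rid)
    (hm : m'.client = i → PacketOK E i ((E.config t).procs i).rid g m') :
    ClientInv E (t + 1) i g := by
  refine h.quiet ?_ (by rw [hb]) (fun e h' => by rw [he] at h'; cases h') ?_ ?_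
  · rw [hp]
    rcases eq_or_ne i k with rfl | hik
    · rwa [Function.update_self]
    · rw [Function.update_of_ne hik]
      exact SameClient.refl _
  · intro m'' hm'' hi
    rw [hT'] at hm''
    rcases Multiset.mem_add.1 hm'' with hm'' | hm''
    · exact Or.inl (hT ▸ Multiset.mem_cons_of_mem hm'')
    · rw [Multiset.mem_singleton.1 hm''] at hi ⊢
      exact Or.inr (hm hi)
  · intro j
    -- The answer takes the slot of the request that it replaces, so no count changes.
    have hiff : m'.InSlot i j ((E.config t).procs i).rid ↔
        m.InSlot i j ((E.config t).procs i).rid := by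
      simp only [Packet.InSlot, hc, hv, hr]
    rw [hT, hT', add_comm, Multiset.singleton_add]
    by_cases hin : m.InSlot i j ((E.config t).procs i).rid
    · rw [slotCount_cons_of_inSlot hin, slotCount_cons_of_inSlot (hiff.2 hin)]
    · rw [slotCount_cons_of_not_inSlot hin, slotCount_cons_of_not_inSlot (mt hiff.1 hin)]

/-- Stale answers do not affect the client. -/
theorem ClientInv.of_stale {i k : Fin n} {g : Phase X} (h : ClientInv E t i g)
    {rest : Multiset (Packet X n)} {m : Packet X n}
    (hp : (E.config (t + 1)).procs = (E.config t).procs)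
    (hb : (E.config (t + 1)).busy = (E.config t).busy)
    (he : E.event t = none) (hk : m.client = k)
    (hr : ((E.config t).procs k).rid ≠ m.msg.rid)
    (hT : (E.config t).transit = m ::ₘ rest) (hT' : (E.config (t + 1)).transit = rest) :
    ClientInv E (t + 1) i g := by
  refine h.quiet ?_ (by rw [hb]) (fun e h' => by rw [he] at h'; cases h') ?_ ?_
  · rw [hp]
    exact SameClient.refl _
  · intro m'' hm'' _
    rw [hT'] at hm''
    exact Or.inl (hT ▸ Multiset.mem_cons_of_mem hm'')
  · intro j
    rw [hT, hT', slotCount_cons_of_not_inSlot]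
    rintro ⟨h1, -, h3⟩
    rw [← h1, hk] at h3
    exact hr h3.symm

end Preservation

/-! ### Preservation by each handler -/

section Preservation

variable {X : Type*} {n : ℕ} {E : Execution X n} {t : ℕ}

theorem quorum_pos (n : ℕ) : 0 < quorum n := Nat.succ_pos _

theorem server_update {k : Fin n} {s : ProcState X n} (h : Invariant E t)
    (hp : (E.config (t + 1)).procs = Function.update (E.config t).procs k s)
    (hs : ServerState E s) (j : Fin n) : ServerState E ((E.config (t + 1)).procs j) := by
  rw [hp]
  rcases eq_or_ne j k with rfl | hjk
  · rwa [Function.update_self]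
  · rw [Function.update_of_ne hjk]
    exact h.server j

theorem Execution.pending_self {i : Fin n} {o : Op X} (he : E.event t = some (.inv i o)) :
    E.Pending t i o (t + 1) :=
  ⟨Nat.lt_succ_self t, he, fun u _ h h' => by omega⟩

theorem ClientInv.eq_idle {i : Fin n} {g : Phase X} (h : ClientInv E t i g)
    (hb : i ∉ (E.config t).busy) : g = .idle := by
  by_contra hg
  exact hb (h.busy.2 hg)

theorem invariant_invoke {k : Fin n} {o : Op X} (h : Invariant E t)
    (hk : k ∉ (E.config t).busy) (he : E.event t = some (.inv k o))
    (hp : (E.config (t + 1)).procs =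
      Function.update (E.config t).procs k (onInvoke k ((E.config t).procs k) o).state)
    (hT : (E.config (t + 1)).transit =
      (E.config t).transit + (onInvoke k ((E.config t).procs k) o).sends)
    (hb : (E.config (t + 1)).busy = insert k (E.config t).busy) : Invariant E (t + 1) := by
  set s := (E.config t).procs k with hs
  have hs' : (E.config (t + 1)).procs k = (onInvoke k s o).state := by
    rw [hp, Function.update_self]
  have hclk : E.clock (t + 1) k = s.lt + 1 := by
    rw [Execution.clock, hs']
    cases o <;> rfl
  refine ⟨server_update h hp ?_, fun i => ?_⟩
  · obtain ⟨h1, h2, -⟩ := onInvoke_mono k s o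
    exact (h.server k).mono h2 h1.le
  obtain ⟨g, hg⟩ := h.client i
  rcases eq_or_ne i k with rfl | hik
  · obtain rfl := hg.eq_idle hk
    have hresp : s.responses = ∅ := hg.state.1
    have hacks : s.acks = ∅ := hg.state.2
    have hempty : (onInvoke i s o).state.responders = ∅ := by
      cases o <;> simp [onInvoke, ProcState.responders, hresp, hacks]
    have hrid : (onInvoke i s o).state.rid = s.rid + 1 := (onInvoke_mono i s o).2.2
    cases o with
    | read r =>
      refine ⟨.query t r, by simp [hb], ?_, ?_⟩
      · change QueryState E (t + 1) i t r _
        exact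
          { pending := Execution.pending_self he
            rid := rfl
            clock := le_rfl
            reading := by rw [hs']; rfl
            rreg := by rw [hs']; rfl
            acks := by rw [hs']; exact hacks
            card_lt := by
              rw [hs']
              change s.responses.card < _
              rw [hresp]
              exact quorum_pos n
            card_image := by
              rw [hs']
              change (s.responses.image _).card = s.responses.card
              rw [hresp]
              rfl
            sampled := fun x hx => by
              rw [hs'] at hx
              change x ∈ s.responses at hx
              simp [hresp] at hx }
      · rw [hs', hempty, hrid, hT]
        refine hg.net.broadcast trivial rfl (fun _ => id) fun j => ?_
        exact ⟨le_rfl, fun _ => ⟨t, rfl, hclk.le⟩⟩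
    | write r v =>
      have hknown : E.Known r (writeTSV (s.lt + 1) i v) := Or.inr ⟨t, i, v, he, by rw [hclk]⟩
      refine ⟨.update t r (writeTSV (s.lt + 1) i v), by simp [hb], ⟨.write r v, ?_⟩, ?_⟩
      · exact
          { pending := Execution.pending_self he
            clock := le_rfl
            known := hknown
            time_le := by rw [hs']; exact le_rfl
            responses := by rw [hs']; exact hresp
            card_lt := by
              rw [hs']
              change s.acks.card < _
              rw [hacks]
              exact quorum_pos n
            secured := fun j hj => by
              rw [hs'] at hj
              change j ∈ s.acks at hj
              simp [hacks] at hj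
            op := ⟨rfl, rfl, by rw [hs']; rfl, by rw [hclk]⟩ }
      · rw [hs', hempty, hrid, hT]
        refine hg.net.broadcast trivial rfl (fun _ => id) fun j => ?_
        exact ⟨le_rfl, le_rfl, hknown, fun _ => ⟨t, rfl⟩⟩
  · refine ⟨g, hg.of_other (T := 0) hik hp ?_ ?_ (zero_add _).symm hT (by simp) ?_⟩
    · rw [hb, Finset.mem_insert]
      simp [hik]
    · intro e h'
      rw [he] at h'
      cases h'
      rfl
    · intro m hm
      cases o <;> exact bcast_client (by trivial) hm

/-- The new clock of the server exceeds the clock in the query, hence the client's clock after the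
invocation, and the server still stores the pair it sends. So the moment after the step witnesses
`Execution.Sampled`. -/
theorem invariant_query {j k : Fin n} {l rid : ℕ} {r : X} {rest : Multiset (Packet X n)}
    (h : Invariant E t)
    (hT : (E.config t).transit = ⟨j, k, .query l rid r⟩ ::ₘ rest)
    (he : E.event t = none)
    (hp : (E.config (t + 1)).procs = Function.update (E.config t).procs k
      (onReceive k ((E.config t).procs k) j (.query l rid r)).state)
    (hT' : (E.config (t + 1)).transit = rest +
      (onReceive k ((E.config t).procs k) j (.query l rid r)).sends)
    (hb : (E.config (t + 1)).busy = (E.config t).busy) : Invariant E (t + 1) := by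
  set s := (E.config t).procs k with hs
  have hs' : (E.config (t + 1)).procs k = (onReceive k s j (.query l rid r)).state := by
    rw [hp, Function.update_self]
  have hle : s.lt ≤ max s.lt l + 1 := by omega
  have hmem : (⟨j, k, .query l rid r⟩ : Packet X n) ∈ (E.config t).transit :=
    hT ▸ Multiset.mem_cons_self _ _
  refine ⟨server_update h hp ((h.server k).mono rfl hle), fun i => ?_⟩
  obtain ⟨g, hg⟩ := h.client i
  refine ⟨g, hg.of_answer hp ⟨rfl, rfl, rfl, rfl, rfl, rfl, hle⟩ hb he hT hT' rfl rfl rfl ?_⟩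
  intro hi
  obtain ⟨h1, h2⟩ := hg.net.packets _ hmem hi
  refine ⟨h1, (h.server k r).2.trans hle, fun hrid => ?_⟩
  obtain ⟨t₀, rfl, hl⟩ := h2 hrid
  refine ⟨t₀, r, rfl, (h.server k r).1, t + 1, ?_, ?_⟩
  · have hclk : E.clock (t + 1) k = max s.lt l + 1 := by
      rw [Execution.clock, hs']
      rfl
    omega
  · rw [Execution.stored, hs']
    exact le_rfl

/-- After the step the server stores at least `τ`, and its clock is the one in the ack; this moment
witnesses `Execution.Secured`. -/
theorem invariant_update {j k : Fin n} {l rid : ℕ} {r : X} {τ : TSV}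
    {rest : Multiset (Packet X n)} (h : Invariant E t)
    (hT : (E.config t).transit = ⟨j, k, .update l rid r τ⟩ ::ₘ rest)
    (he : E.event t = none)
    (hp : (E.config (t + 1)).procs = Function.update (E.config t).procs k
      (onReceive k ((E.config t).procs k) j (.update l rid r τ)).state)
    (hT' : (E.config (t + 1)).transit = rest +
      (onReceive k ((E.config t).procs k) j (.update l rid r τ)).sends)
    (hb : (E.config (t + 1)).busy = (E.config t).busy) : Invariant E (t + 1) := by
  set s := (E.config t).procs k with hs
  have hs' : (E.config (t + 1)).procs k = (onReceive k s j (.update l rid r τ)).state := by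
    rw [hp, Function.update_self]
  have hle : s.lt ≤ max s.lt l + 1 := by omega
  have hmem : (⟨j, k, .update l rid r τ⟩ : Packet X n) ∈ (E.config t).transit :=
    hT ▸ Multiset.mem_cons_self _ _
  refine ⟨server_update h hp ?_, fun i => ?_⟩
  -- Servers also accept stale updates, so origin and time bound are taken from the clauses of
  -- `PacketOK` that do not depend on the identifier.
  · obtain ⟨g, hg⟩ := h.client j
    obtain ⟨-, h1, h2, -⟩ := hg.net.packets _ hmem rfl
    intro r'
    obtain ⟨h3, h4⟩ := h.server k r'
    simp only [onReceive, Function.update_apply]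
    split_ifs with hr
    · subst hr
      rcases max_choice (s.tvps r') τ with hm | hm <;> rw [hm]
      · exact ⟨h3, h4.trans hle⟩
      · exact ⟨h2, by omega⟩
    · exact ⟨h3, h4.trans hle⟩
  · obtain ⟨g, hg⟩ := h.client i
    refine ⟨g, hg.of_answer hp ⟨rfl, rfl, rfl, rfl, rfl, rfl, hle⟩ hb he hT hT' rfl rfl rfl ?_⟩
    intro hi
    obtain ⟨h1, -, -, h2⟩ := hg.net.packets _ hmem hi
    refine ⟨h1, fun hrid => ?_⟩
    obtain ⟨t₀, rfl⟩ := h2 hrid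
    refine ⟨t₀, r, τ, rfl, t + 1, ?_, ?_⟩
    · rw [Execution.clock, hs']
      exact le_rfl
    · rw [Execution.stored, hs']
      simp [onReceive]

theorem invariant_stale {j k : Fin n} {M : Msg X} {rest : Multiset (Packet X n)}
    (h : Invariant E t) (hk : (Packet.mk j k M).client = k)
    (hr : ((E.config t).procs k).rid ≠ M.rid)
    (hT : (E.config t).transit = ⟨j, k, M⟩ ::ₘ rest) (he : E.event t = none)
    (hp : (E.config (t + 1)).procs = (E.config t).procs)
    (hT' : (E.config (t + 1)).transit = rest)
    (hb : (E.config (t + 1)).busy = (E.config t).busy) : Invariant E (t + 1) := by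
  refine ⟨fun j => by rw [hp]; exact h.server j, fun i => ?_⟩
  obtain ⟨g, hg⟩ := h.client i
  exact ⟨g, hg.of_stale hp hb he hk hr hT hT'⟩

theorem invariant_response {j k : Fin n} {l rid : ℕ} {τ : TSV}
    {rest : Multiset (Packet X n)} (h : Invariant E t)
    (hT : (E.config t).transit = ⟨j, k, .response l rid τ⟩ ::ₘ rest)
    (he : E.event t = (onReceive k ((E.config t).procs k) j (.response l rid τ)).ret.map
      (Event.res k))
    (hp : (E.config (t + 1)).procs = Function.update (E.config t).procs k
      (onReceive k ((E.config t).procs k) j (.response l rid τ)).state)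
    (hT' : (E.config (t + 1)).transit = rest +
      (onReceive k ((E.config t).procs k) j (.response l rid τ)).sends)
    (hb : (E.config (t + 1)).busy =
      if (onReceive k ((E.config t).procs k) j (.response l rid τ)).ret.isSome then
        (E.config t).busy.erase k else (E.config t).busy) : Invariant E (t + 1) := by
  set s := (E.config t).procs k with hs
  by_cases hrid : s.rid = rid
  swap
  · rw [onReceive_response_stale k s j l rid τ hrid] at he hp hT' hb
    rw [hs, Function.update_eq_self] at hp
    rw [add_zero] at hT'
    exact invariant_stale h rfl hrid hT he hp hT' hb
  subst hrid
  have hmem : (⟨j, k, .response l s.rid τ⟩ : Packet X n) ∈ (E.config t).transit :=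
    hT ▸ Multiset.mem_cons_self _ _
  have hle : s.lt ≤ max s.lt l + 1 := by omega
  obtain ⟨g, hg⟩ := h.client k
  obtain ⟨-, hτl, h2⟩ := hg.net.packets _ hmem rfl
  obtain ⟨t₀, r, rfl, hknown, hsamp⟩ := h2 rfl
  have hst : QueryState E t k t₀ r s := hg.state
  have hslot : (⟨j, k, .response l s.rid τ⟩ : Packet X n).InSlot k j s.rid := ⟨rfl, rfl, rfl⟩
  have hj := hg.net.not_mem_of_inSlot (by simp) hmem hslot
  have hj' : j ∉ s.responses.image fun x => (ofLex x).2 := fun h' =>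
    hj (Finset.mem_union_left _ h')
  have hnew : toLex (τ, j) ∉ s.responses := fun h' =>
    hj' (Finset.mem_image.2 ⟨_, h', rfl⟩)
  set R := insert (toLex (τ, j)) s.responses with hR
  have hRcard : R.card = s.responses.card + 1 := Finset.card_insert_of_notMem hnew
  have hRimage : R.image (fun x => (ofLex x).2) =
      insert j (s.responses.image fun x => (ofLex x).2) := Finset.image_insert _ _ _
  -- The set consists of pairs; its size counts processes only because no sender occurs in it twice.
  have hRcard' : (R.image fun x => (ofLex x).2).card = R.card := by
    rw [hRimage, Finset.card_insert_of_notMem hj', hst.card_image, hRcard]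
  have hRs : ∀ x ∈ R, E.Known r (ofLex x).1 ∧ tsvTime (ofLex x).1 ≤ max s.lt l + 1 ∧
      E.Sampled (E.clock (t₀ + 1) k) (ofLex x).2 r (ofLex x).1 := by
    intro x hx
    rcases Finset.mem_insert.1 hx with rfl | hx
    · exact ⟨hknown, by change tsvTime τ ≤ _; omega, hsamp⟩
    · obtain ⟨ha, hb, hc⟩ := hst.sampled x hx
      exact ⟨ha, hb.trans hle, hc⟩
  have hTsplit : (E.config t).transit = {⟨j, k, .response l s.rid τ⟩} + rest := hT
  by_cases hq : R.card = quorum n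
  · obtain ⟨x, hx, hmax, heq⟩ := onReceive_response_quorum k s j l s.rid τ rfl hq
    rw [heq] at he hp hT' hb
    have hs' := congrFun hp k
    rw [Function.update_self] at hs'
    obtain ⟨hkx, htx, -⟩ := hRs x hx
    refine ⟨server_update h hp ((h.server k).mono rfl hle), fun i => ?_⟩
    rcases eq_or_ne i k with rfl | hik
    · refine ⟨.update t₀ r (ofLex x).1, ?_, ⟨.read r, ?_⟩, ?_⟩
      · rw [hb]
        simpa using hg.busy.2 (by simp)
      · rw [hs']
        exact
          { pending := hst.pending.succ fun e h' => by rw [he] at h'; cases h'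
            clock := hst.clock.trans hle
            known := hkx
            time_le := htx
            responses := rfl
            card_lt := by
              change s.acks.card < _
              rw [hst.acks]
              exact quorum_pos n
            secured := fun j hj => by
              change j ∈ s.acks at hj
              simp [hst.acks] at hj
            op := by
              refine ⟨rfl, congrArg (· + 1) hst.rid, hst.reading, rfl,
                R.image (fun x => (ofLex x).2), hRcard'.trans hq, fun q hq => ?_⟩
              obtain ⟨y, hy, rfl⟩ := Finset.mem_image.1 hq
              obtain ⟨u, hu, hu'⟩ := (hRs y hy).2.2
              -- The chosen pair dominates every pair in `R`, so it bounds what each member of the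
              -- majority stored when sampled.
              refine ⟨u, hu, hu'.trans ?_⟩
              exact Prod.Lex.monotone_fst _ _ (hmax y hy) }
      · have hempty : ((E.config (t + 1)).procs i).responders = ∅ := by
          rw [hs']
          simp [ProcState.responders, hst.acks]
        rw [hempty, hs', hT']
        refine hg.net.broadcast trivial rfl
          (fun m hm => hT ▸ Multiset.mem_cons_of_mem hm) fun j => ?_
        refine ⟨le_rfl, htx, ?_, fun _ => ⟨t₀, ?_⟩⟩
        · rw [hst.rreg]
          exact hkx
        · rw [hst.rreg]
    · obtain ⟨g', hg'⟩ := h.client i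
      refine ⟨g', hg'.of_other hik hp (by rw [hb]; simp) ?_ hTsplit hT' ?_ ?_⟩
      · intro e h'
        rw [he] at h'
        cases h'
      · intro m hm
        rw [Multiset.mem_singleton.1 hm]
        rfl
      · exact fun m hm => bcast_client (by trivial) hm
  · have heq := onReceive_response_insert k s j l s.rid τ rfl hq
    rw [heq] at he hp hT' hb
    rw [add_zero] at hT'
    have hs' := congrFun hp k
    rw [Function.update_self] at hs'
    refine ⟨server_update h hp ((h.server k).mono rfl hle), fun i => ?_⟩
    rcases eq_or_ne i k with rfl | hik
    · refine ⟨.query t₀ r, ?_, ?_, ?_⟩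
      · rw [hb]
        simpa using hg.busy.2 (by simp)
      · rw [hs']
        change QueryState E (t + 1) i t₀ r _
        exact
          { pending := hst.pending.succ fun e h' => by rw [he] at h'; cases h'
            rid := hst.rid
            clock := hst.clock.trans hle
            reading := hst.reading
            rreg := hst.rreg
            acks := hst.acks
            card_lt := by
              have := hst.card_lt
              change R.card < _
              omega
            card_image := hRcard'
            sampled := hRs }
      · rw [hs', hT']
        have hnet := hg.net
        rw [hT] at hnet
        refine hnet.hear (by simp) hslot fun q => ?_
        change q ∈ R.image _ ∪ s.acks ↔ _ ∨ q ∈ s.responses.image _ ∪ s.acks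
        rw [hRimage, Finset.mem_union, Finset.mem_union, Finset.mem_insert, or_assoc]
    · obtain ⟨g', hg'⟩ := h.client i
      refine ⟨g', hg'.of_other (S := 0) hik hp (by rw [hb]; simp) ?_ hTsplit
        (by rw [hT', add_zero]) ?_ (by simp)⟩
      · intro e h'
        rw [he] at h'
        cases h'
      · intro m hm
        rw [Multiset.mem_singleton.1 hm]
        rfl

theorem invariant_ack {j k : Fin n} {l rid : ℕ} {rest : Multiset (Packet X n)}
    (h : Invariant E t)
    (hT : (E.config t).transit = ⟨j, k, .ack l rid⟩ ::ₘ rest)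
    (he : E.event t = (onReceive k ((E.config t).procs k) j (.ack l rid)).ret.map
      (Event.res k))
    (hp : (E.config (t + 1)).procs = Function.update (E.config t).procs k
      (onReceive k ((E.config t).procs k) j (.ack l rid)).state)
    (hT' : (E.config (t + 1)).transit = rest +
      (onReceive k ((E.config t).procs k) j (.ack l rid)).sends)
    (hb : (E.config (t + 1)).busy =
      if (onReceive k ((E.config t).procs k) j (.ack l rid)).ret.isSome then
        (E.config t).busy.erase k else (E.config t).busy) : Invariant E (t + 1) := by
  set s := (E.config t).procs k with hs
  by_cases hrid : s.rid = rid
  swap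
  · rw [onReceive_ack_stale k s j l rid hrid] at he hp hT' hb
    rw [hs, Function.update_eq_self] at hp
    rw [add_zero] at hT'
    exact invariant_stale h rfl hrid hT he hp hT' hb
  subst hrid
  have hmem : (⟨j, k, .ack l s.rid⟩ : Packet X n) ∈ (E.config t).transit :=
    hT ▸ Multiset.mem_cons_self _ _
  have hle : s.lt ≤ max s.lt l + 1 := by omega
  obtain ⟨g, hg⟩ := h.client k
  obtain ⟨-, h2⟩ := hg.net.packets _ hmem rfl
  obtain ⟨t₀, r, τ, rfl, hsec⟩ := h2 rfl
  obtain ⟨o, hst⟩ := hg.state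
  have hslot : (⟨j, k, .ack l s.rid⟩ : Packet X n).InSlot k j s.rid := ⟨rfl, rfl, rfl⟩
  have hj := hg.net.not_mem_of_inSlot (by simp) hmem hslot
  have hTsplit : (E.config t).transit = {⟨j, k, .ack l s.rid⟩} + rest := hT
  by_cases hq : (insert j s.acks).card = quorum n
  · have heq := onReceive_ack_quorum k s j l s.rid rfl hq
    rw [heq] at he hp hT' hb
    rw [add_zero] at hT'
    have hs' := congrFun hp k
    rw [Function.update_self] at hs'
    refine ⟨server_update h hp ((h.server k).mono rfl hle), fun i => ?_⟩
    rcases eq_or_ne i k with rfl | hik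
    · refine ⟨.idle, ?_, ?_, ?_⟩
      · rw [hb]
        simp
      · rw [hs']
        exact ⟨hst.responses, rfl⟩
      · rw [hs', hT']
        exact hg.net.finish _ fun m hm => hT ▸ Multiset.mem_cons_of_mem hm
    · obtain ⟨g', hg'⟩ := h.client i
      refine ⟨g', hg'.of_other (S := 0) hik hp (by rw [hb]; simp [hik]) ?_ hTsplit
        (by rw [hT', add_zero]) ?_ (by simp)⟩
      · intro e h'
        rw [he] at h'
        cases h'
        rfl
      · intro m hm
        rw [Multiset.mem_singleton.1 hm]
        rfl
  · have heq := onReceive_ack_insert k s j l s.rid rfl hq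
    rw [heq] at he hp hT' hb
    rw [add_zero] at hT'
    have hs' := congrFun hp k
    rw [Function.update_self] at hs'
    refine ⟨server_update h hp ((h.server k).mono rfl hle), fun i => ?_⟩
    rcases eq_or_ne i k with rfl | hik
    · refine ⟨.update t₀ r τ, ?_, ⟨o, ?_⟩, ?_⟩
      · rw [hb]
        simpa using hg.busy.2 (by simp)
      · rw [hs']
        exact
          { pending := hst.pending.succ fun e h' => by rw [he] at h'; cases h'
            clock := hst.clock.trans hle
            known := hst.known
            time_le := hst.time_le.trans hle
            responses := hst.responses
            card_lt := by
              have h1 : s.acks.card < quorum n := hst.card_lt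
              have h2 : (insert j s.acks).card ≤ s.acks.card + 1 := Finset.card_insert_le _ _
              change (insert j s.acks).card < _
              omega
            secured := fun q hq => by
              change q ∈ insert j s.acks at hq
              rcases Finset.mem_insert.1 hq with rfl | hq
              · exact hsec.mono (by change l ≤ max s.lt l + 1; omega)
              · exact (hst.secured q hq).mono hle
            op := by
              have := hst.op
              cases o <;> exact this }
      · rw [hs', hT']
        have hnet := hg.net
        rw [hT] at hnet
        refine hnet.hear (by simp) hslot fun q => ?_
        change q ∈ s.responses.image _ ∪ insert j s.acks ↔ _ ∨ q ∈ s.responses.image _ ∪ s.acks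
        rw [Finset.mem_union, Finset.mem_union, Finset.mem_insert, or_left_comm]
    · obtain ⟨g', hg'⟩ := h.client i
      refine ⟨g', hg'.of_other (S := 0) hik hp (by rw [hb]; simp) ?_ hTsplit
        (by rw [hT', add_zero]) ?_ (by simp)⟩
      · intro e h'
        rw [he] at h'
        cases h'
      · intro m hm
        rw [Multiset.mem_singleton.1 hm]
        rfl

theorem invariant_succ (h : Invariant E t) : Invariant E (t + 1) := by
  rcases (E.trans t).elim_cases with ⟨hp, hT, hb, he, -⟩ | ⟨k, o, hk, he, hp, hT, hb, -⟩ |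
    ⟨j, k, M, rest, -, hT, he, hp, hT', hb⟩
  · refine ⟨fun j => by rw [hp]; exact h.server j, fun i => ?_⟩
    obtain ⟨g, hg⟩ := h.client i
    refine ⟨g, hg.quiet (by rw [hp]; exact SameClient.refl _) (by rw [hb])
      (fun e h' => by rw [he] at h'; cases h') (fun m hm _ => Or.inl (hT ▸ hm))
      fun j => by rw [hT]⟩
  · exact invariant_invoke h hk he hp hT hb
  · cases M with
    | query l rid r => exact invariant_query h hT he hp hT' hb
    | response l rid τ => exact invariant_response h hT he hp hT' hb
    | update l rid r τ => exact invariant_update h hT he hp hT' hb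
    | ack l rid => exact invariant_ack h hT he hp hT' hb

variable (E) in
theorem invariant (t : ℕ) : Invariant E t := by
  induction t with
  | zero => exact invariant_zero E
  | succ t ih => exact invariant_succ ih

end Preservation

/-! ### Facts available when an operation returns -/

section Responses

variable {X : Type*} {n : ℕ} {E : Execution X n}

/-- The register of an operation. -/
def Op.reg : Op X → X
  | .read r => r
  | .write r _ => r

/-- The facts about an operation `o` invoked by `i` at time `t₀` that returns `a` at time `t`. -/
structure OpRecord (E : Execution X n) (t₀ t : ℕ) (i : Fin n) (o : Op X) (a : Ret) (τ : TSV) :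
    Prop where
  clock : E.clock (t₀ + 1) i ≤ E.clock (t + 1) i
  known : E.Known o.reg τ
  time_le : tsvTime τ ≤ E.clock (t + 1) i
  secured : ∃ Q : Finset (Fin n), Q.card = quorum n ∧
    ∀ j ∈ Q, E.Secured (E.clock (t + 1) i) j o.reg τ
  read : ∀ r, o = .read r → a = .value (ofLex τ).2 ∧
    ∃ Q : Finset (Fin n), Q.card = quorum n ∧ ∀ j ∈ Q, E.Sampled (E.clock (t₀ + 1) i) j r τ
  write : ∀ r v, o = .write r v → τ = writeTSV (E.clock (t₀ + 1) i) i v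

theorem Execution.Pending.unique {t₀ t₁ t : ℕ} {i : Fin n} {o₀ o₁ : Op X}
    (h₀ : E.Pending t₀ i o₀ t) (h₁ : E.Pending t₁ i o₁ t) : t₀ = t₁ ∧ o₀ = o₁ := by
  have ht : t₀ = t₁ := by
    rcases lt_trichotomy t₀ t₁ with h | h | h
    · exact absurd rfl (h₀.2.2 t₁ _ h h₁.1 h₁.2.1)
    · exact h
    · exact absurd rfl (h₁.2.2 t₀ _ h h₀.1 h₀.2.1)
  subst ht
  have := h₀.2.1.symm.trans h₁.2.1
  simp only [Option.some.injEq, Event.inv.injEq, true_and] at this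
  exact ⟨rfl, this⟩

/-- Only a current ack that completes a majority returns. The invariant then puts the client in an
update phase, and the record is read off from it, the last ack supplying the last member of the
majority. -/
theorem exists_opRecord {t : ℕ} {i : Fin n} {a : Ret} (h : E.event t = some (.res i a)) :
    ∃ t₀ o τ, E.Pending t₀ i o t ∧ o.Accepts a ∧ OpRecord E t₀ t i o a τ := by
  rcases (E.trans t).elim_cases with ⟨-, -, -, he, -⟩ | ⟨k, o, -, he, -⟩ |
    ⟨j, k, M, rest, -, hT, he, hp, -, -⟩
  · rw [he] at h
    cases h
  · rw [he] at h
    cases h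
  rw [h] at he
  cases M with
  | query l rid r => cases he
  | update l rid r τ => cases he
  | response l rid τ =>
    exfalso
    by_cases hrid : ((E.config t).procs k).rid = rid
    · by_cases hq : (insert (toLex (τ, j)) ((E.config t).procs k).responses).card = quorum n
      · obtain ⟨x, -, -, hx⟩ := onReceive_response_quorum k _ j l rid τ hrid hq
        rw [hx] at he
        cases he
      · rw [onReceive_response_insert k _ j l rid τ hrid hq] at he
        cases he
    · rw [onReceive_response_stale k _ j l rid τ hrid] at he
      cases he
  | ack l rid =>
    by_cases hrid : ((E.config t).procs k).rid = rid
    swap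
    · rw [onReceive_ack_stale k _ j l rid hrid] at he
      cases he
    by_cases hq : (insert j ((E.config t).procs k).acks).card = quorum n
    swap
    · rw [onReceive_ack_insert k _ j l rid hrid hq] at he
      cases he
    rw [onReceive_ack_quorum k _ j l rid hrid hq] at he hp
    simp only [Option.map_some, Option.some.injEq, Event.res.injEq] at he
    obtain ⟨rfl, rfl⟩ := he
    have hclk : E.clock (t + 1) i = max (E.clock t i) l + 1 := by
      unfold Execution.clock
      rw [hp, Function.update_self]
    have hle : E.clock t i ≤ E.clock (t + 1) i := by omega
    obtain ⟨g, hg⟩ := (invariant E t).client i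
    obtain ⟨-, h2⟩ := hg.net.packets _ (hT ▸ Multiset.mem_cons_self _ _) rfl
    obtain ⟨t₀, r, τ, rfl, hsec⟩ := h2 hrid.symm
    obtain ⟨o, hst⟩ := hg.state
    have hop := hst.op
    have hreg : o.reg = r := by
      cases o <;> exact hop.1
    refine ⟨t₀, o, τ, hst.pending, ?_, hst.clock.trans hle, ?_, hst.time_le.trans hle,
      ⟨_, hq, fun q hq => ?_⟩, ?_, ?_⟩
    · cases o with
      | read r' => simp [hop.2.2.1, Op.Accepts]
      | write r' v => simp [hop.2.2.1, Op.Accepts]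
    · rw [hreg]
      exact hst.known
    · rw [hreg]
      rcases Finset.mem_insert.1 hq with rfl | hq
      · exact hsec.mono (by omega)
      · exact (hst.secured q hq).mono hle
    · rintro r' rfl
      obtain ⟨rfl, -, h3, h4, h5⟩ := hop
      refine ⟨?_, h5⟩
      rw [if_pos h3, h4]
    · rintro r' v rfl
      exact hop.2.2.2

/-- A busy process cannot invoke, so its next event can only be a response. -/
theorem busy_and_pending {t₀ t : ℕ} {i : Fin n} {o : Op X} (h : E.event t₀ = some (.inv i o))
    (ht : t₀ < t) (hres : ∀ u a, t₀ < u → u < t → E.event u ≠ some (.res i a)) :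
    i ∈ (E.config t).busy ∧ E.Pending t₀ i o t := by
  induction t, ht using Nat.le_induction with
  | base =>
    refine ⟨?_, Execution.pending_self h⟩
    rcases (E.trans t₀).elim_cases with ⟨-, -, -, he, -⟩ | ⟨k, o', -, he, -, -, hb, -⟩ |
      ⟨j, k, M, rest, -, -, he, -⟩
    · rw [he] at h
      cases h
    · rw [he] at h
      cases h
      simp [hb]
    · rw [he, Option.map_eq_some_iff] at h
      obtain ⟨a, -, ha⟩ := h
      cases ha
  | succ t ht ih =>
    obtain ⟨hb, hpend⟩ := ih fun u a hu hu' => hres u a hu (by omega)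
    have hno := fun a => hres t a ht (Nat.lt_succ_self t)
    rcases (E.trans t).elim_cases with ⟨-, -, hb', he, -⟩ | ⟨k, o', hk, he, -, -, hb', -⟩ |
      ⟨j, k, M, rest, -, -, he, -, -, hb'⟩
    · exact ⟨hb' ▸ hb, hpend.succ fun e h' => by rw [he] at h'; cases h'⟩
    · refine ⟨by simp [hb', hb], hpend.succ fun e h' => ?_⟩
      rw [he] at h'
      cases h'
      rintro rfl
      exact hk hb
    · cases hr : (onReceive k ((E.config t).procs k) j M).ret with
      | none =>
        rw [hr] at he hb'
        refine ⟨by simpa [hb'] using hb, hpend.succ fun e h' => ?_⟩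
        rw [he] at h'
        cases h'
      | some a =>
        rw [hr] at he hb'
        have hik : k ≠ i := by
          rintro rfl
          exact hno a he
        refine ⟨by simpa [hb', hik.symm] using hb, hpend.succ fun e h' => ?_⟩
        rw [he] at h'
        cases h'
        exact hik

theorem completesBetween_of_response {t₀ t : ℕ} {i : Fin n} {o : Op X} {a : Ret}
    (h : E.event t₀ = some (.inv i o)) (ht : t₀ < t) (hr : E.event t = some (.res i a)) :
    ∃ u b, CompletesBetween E.event t₀ u i o b := by
  classical
  -- The matching response is the first one after `t₀`, which may precede `t`.
  have hex : ∃ u, t₀ < u ∧ ∃ b, E.event u = some (.res i b) := ⟨t, ht, a, hr⟩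
  obtain ⟨hu, b, hb⟩ := Nat.find_spec hex
  obtain ⟨-, hpend⟩ := busy_and_pending h hu fun v c hv hv' hc => Nat.find_min hex hv' ⟨hv, c, hc⟩
  obtain ⟨t₁, o₁, τ, hpend', hacc, -⟩ := exists_opRecord hb
  obtain ⟨rfl, rfl⟩ := hpend.unique hpend'
  exact ⟨_, b, hu, h, hb, hacc, hpend.2.2⟩

end Responses

/-! ### Termination -/

section Termination

variable {X : Type*} {n : ℕ} {E : Execution X n}

/-- A handler that empties the sets of answers also raises the request identifier; while it is
unchanged, responders only accumulate. -/
theorem onReceive_responders (i : Fin n) (s : ProcState X n) (j : Fin n) (M : Msg X)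
    (hrid : (onReceive i s j M).state.rid = s.rid) :
    s.responders ⊆ (onReceive i s j M).state.responders ∧
      (¬ M.IsRequest → M.rid = s.rid → j ∈ (onReceive i s j M).state.responders) := by
  cases M with
  | query l rid r => exact ⟨subset_rfl, fun h => absurd trivial h⟩
  | update l rid r τ => exact ⟨subset_rfl, fun h => absurd trivial h⟩
  | response l rid τ =>
    by_cases h : s.rid = rid
    · by_cases hq : (insert (toLex (τ, j)) s.responses).card = quorum n
      · obtain ⟨x, -, -, hx⟩ := onReceive_response_quorum i s j l rid τ h hq
        rw [hx] at hrid
        exact absurd hrid (Nat.succ_ne_self _)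
      · rw [onReceive_response_insert i s j l rid τ h hq]
        refine ⟨Finset.union_subset_union_left
          (Finset.image_subset_image (Finset.subset_insert _ _)), fun _ _ => ?_⟩
        exact Finset.mem_union_left _
          (Finset.mem_image.2 ⟨toLex (τ, j), Finset.mem_insert_self _ _, rfl⟩)
    · rw [onReceive_response_stale i s j l rid τ h]
      exact ⟨subset_rfl, fun _ h' => absurd h'.symm h⟩
  | ack l rid =>
    by_cases h : s.rid = rid
    · by_cases hq : (insert j s.acks).card = quorum n
      · rw [onReceive_ack_quorum i s j l rid h hq] at hrid
        exact absurd hrid (Nat.succ_ne_self _)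
      · rw [onReceive_ack_insert i s j l rid h hq]
        exact ⟨Finset.union_subset_union_right (Finset.subset_insert _ _),
          fun _ _ => Finset.mem_union_right _ (Finset.mem_insert_self _ _)⟩
    · rw [onReceive_ack_stale i s j l rid h]
      exact ⟨subset_rfl, fun _ h' => absurd h'.symm h⟩

theorem responders_succ {t : ℕ} {i : Fin n}
    (hrid : ((E.config (t + 1)).procs i).rid = ((E.config t).procs i).rid) :
    ((E.config t).procs i).responders ⊆ ((E.config (t + 1)).procs i).responders := by
  rcases (E.trans t).elim_cases with ⟨hp, -⟩ | ⟨k, o, -, -, hp, -⟩ |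
    ⟨j, k, M, rest, -, -, -, hp, -⟩
  · rw [hp]
  · rcases eq_or_ne i k with rfl | hik
    · rw [hp, Function.update_self, (onInvoke_mono i _ o).2.2] at hrid
      exact absurd hrid (Nat.succ_ne_self _)
    · rw [hp, Function.update_of_ne hik]
  · rcases eq_or_ne i k with rfl | hik
    · rw [hp, Function.update_self] at hrid ⊢
      exact (onReceive_responders i _ j M hrid).1
    · rw [hp, Function.update_of_ne hik]

theorem mem_responders_of_receive {t : ℕ} {i j : Fin n} {M : Msg X} (hM : ¬ M.IsRequest)
    (hstep : E.step t = .receive ⟨j, i, M⟩) (hr : M.rid = ((E.config t).procs i).rid)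
    (hrid : ((E.config (t + 1)).procs i).rid = ((E.config t).procs i).rid) :
    j ∈ ((E.config (t + 1)).procs i).responders := by
  rcases (E.trans t).elim_cases with ⟨-, -, -, -, h⟩ | ⟨k, o, -, -, -, -, -, h⟩ |
    ⟨j', k, M', rest, h, -, -, hp, -⟩
  · exact absurd hstep (h _)
  · exact absurd hstep (h _)
  · rw [hstep] at h
    cases h
    rw [hp, Function.update_self] at hrid ⊢
    exact (onReceive_responders i _ j M hrid).2 hM hr

theorem exists_answer_of_receive {t : ℕ} {i j : Fin n} {M : Msg X} (hM : M.IsRequest)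
    (hstep : E.step t = .receive ⟨i, j, M⟩) :
    ∃ M' : Msg X, ¬ M'.IsRequest ∧ M'.rid = M.rid ∧ ⟨j, i, M'⟩ ∈ (E.config (t + 1)).transit := by
  rcases (E.trans t).elim_cases with ⟨-, -, -, -, h⟩ | ⟨k, o, -, -, -, -, -, h⟩ |
    ⟨j', k, M', rest, h, -, -, -, hT, -⟩
  · exact absurd hstep (h _)
  · exact absurd hstep (h _)
  · rw [hstep] at h
    cases h
    rw [hT]
    cases M with
    | query l rid r =>
      exact ⟨.response (max ((E.config t).procs j).lt l + 1) rid (((E.config t).procs j).tvps r),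
        id, rfl, Multiset.mem_add.2 (Or.inr (Multiset.mem_singleton_self _))⟩
    | update l rid r τ =>
      exact ⟨.ack (max ((E.config t).procs j).lt l + 1) rid, id, rfl, Multiset.mem_add.2 (Or.inr (Multiset.mem_singleton_self _))⟩
    | response l rid τ => exact hM.elim
    | ack l rid => exact hM.elim

theorem ClientState.card_responders_lt {t : ℕ} {i : Fin n} {s : ProcState X n} {g : Phase X}
    (h : ClientState E t i s g) : s.responders.card < quorum n := by
  unfold ProcState.responders
  cases g with
  | idle =>
    rw [h.1, h.2]
    exact quorum_pos n
  | query t₀ r =>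
    change QueryState E t i t₀ r s at h
    rw [h.acks, Finset.union_empty, h.card_image]
    exact h.card_lt
  | update t₀ r τ =>
    obtain ⟨o, h⟩ := h
    rw [h.responses, Finset.image_empty, Finset.empty_union]
    exact h.card_lt

/-- While pending, a read raises the identifier only when it passes to its update phase, and a write
not at all. -/
theorem rid_le_of_pending {t₀ t : ℕ} {i : Fin n} {o : Op X} (hb : i ∈ (E.config t).busy)
    (hpend : E.Pending t₀ i o t) :
    ((E.config t).procs i).rid ≤ ((E.config (t₀ + 1)).procs i).rid + 1 := by
  obtain ⟨g, hg⟩ := (invariant E t).client i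
  cases g with
  | idle => exact absurd rfl (hg.busy.1 hb)
  | query t₁ r =>
    have hst : QueryState E t i t₁ r _ := hg.state
    obtain ⟨rfl, -⟩ := hpend.unique hst.pending
    rw [hst.rid]
    exact Nat.le_succ _
  | update t₁ r τ =>
    obtain ⟨o', hst⟩ := hg.state
    obtain ⟨rfl, rfl⟩ := hpend.unique hst.pending
    have := hst.op
    cases o with
    | read r' => exact this.2.1.le
    | write r' v => exact this.2.1.le.trans (Nat.le_succ _)

theorem exists_forall_eq_of_bounded {f : ℕ → ℕ} (hf : Monotone f) (B T : ℕ)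
    (hB : ∀ u, T ≤ u → f u ≤ B) : ∃ U, T ≤ U ∧ ∀ u, U ≤ u → f u = f U := by
  by_contra hcon
  push Not at hcon
  have : ∀ k, ∃ U, T ≤ U ∧ k ≤ f U := by
    intro k
    induction k with
    | zero => exact ⟨T, le_rfl, Nat.zero_le _⟩
    | succ k ih =>
      obtain ⟨U, hU, hk⟩ := ih
      obtain ⟨u, hu, hne⟩ := hcon U hU
      have := hf hu
      exact ⟨u, hU.trans hu, by omega⟩
  obtain ⟨U, hU, hk⟩ := this (B + 1)
  have := hB U hU
  omega

/-- If `j` has not been heard from, its slot holds a packet: an answer, or a request whose delivery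
creates one. The answer is still current when it arrives, because the identifier no longer changes.
-/
theorem exists_mem_responders {T : ℕ} {i j : Fin n} (hE : E.EventualDelivery)
    (hi : i ∉ E.faulty) (hj : j ∉ E.faulty) (hb : i ∈ (E.config T).busy)
    (hrid : ∀ u, T ≤ u → ((E.config u).procs i).rid = ((E.config T).procs i).rid) :
    ∃ u, T ≤ u ∧ j ∈ ((E.config u).procs i).responders := by
  have hanswer : ∀ t (M : Msg X), T ≤ t → ¬ M.IsRequest → M.rid = ((E.config T).procs i).rid →
      ⟨j, i, M⟩ ∈ (E.config t).transit → ∃ u, T ≤ u ∧ j ∈ ((E.config u).procs i).responders := by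
    intro t M ht hM hr hmem
    obtain ⟨u, hu, hstep⟩ := hE t _ hmem hj hi
    have h1 := hrid u (ht.trans hu)
    have h2 := hrid (u + 1) (by omega)
    exact ⟨u + 1, by omega,
      mem_responders_of_receive hM hstep (hr.trans h1.symm) (h2.trans h1.symm)⟩
  obtain ⟨g, hg⟩ := (invariant E T).client i
  have hslot := hg.net.slots (hg.busy.1 hb) j
  split_ifs at hslot with hjr
  · exact ⟨T, le_rfl, hjr⟩
  obtain ⟨⟨a, b, M⟩, hm, hc, hv, hr⟩ := exists_inSlot_of_slotCount_pos (by omega :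
    0 < slotCount i j ((E.config T).procs i).rid (E.config T).transit)
  by_cases hM : M.IsRequest
  · rw [client_of_isRequest hM] at hc
    rw [server_of_isRequest hM] at hv
    subst hc hv
    obtain ⟨u, hu, hstep⟩ := hE T _ hm hi hj
    obtain ⟨M', hM', hr', hmem⟩ := exists_answer_of_receive hM hstep
    exact hanswer (u + 1) M' (by omega) hM' (hr'.trans hr) hmem
  · have hab : a = j ∧ b = i := by
      cases M
      · exact absurd trivial hM
      · exact ⟨hv, hc⟩
      · exact absurd trivial hM
      · exact ⟨hv, hc⟩
    obtain ⟨rfl, rfl⟩ := hab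
    exact hanswer T M le_rfl hM hr hm

theorem Execution.exists_response {f : ℕ} (hf : 2 * f < n) (hfaulty : E.faulty.ncard ≤ f)
    (hE : E.EventualDelivery) {t₀ : ℕ} {i : Fin n} {o : Op X} (hi : i ∉ E.faulty)
    (h : E.event t₀ = some (.inv i o)) : ∃ t a, t₀ < t ∧ E.event t = some (.res i a) := by
  by_contra hcon
  push Not at hcon
  have hbp : ∀ t, t₀ < t → i ∈ (E.config t).busy ∧ E.Pending t₀ i o t := fun t ht =>
    busy_and_pending h ht fun u a hu _ => hcon u a hu
  obtain ⟨T, hT, hrid⟩ := exists_forall_eq_of_bounded (E.rid_mono i) _ (t₀ + 1)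
    fun u hu => rid_le_of_pending (hbp u hu).1 (hbp u hu).2
  have hmono : ∀ u v, T ≤ u → u ≤ v →
      ((E.config u).procs i).responders ⊆ ((E.config v).procs i).responders := by
    intro u v hu huv
    induction v, huv using Nat.le_induction with
    | base => exact subset_rfl
    | succ v hv ih =>
      exact ih.trans (responders_succ
        ((hrid (v + 1) (by omega)).trans (hrid v (by omega)).symm))
  have hall : ∀ j : Fin n, ∃ u, j ∉ E.faulty → T ≤ u ∧ j ∈ ((E.config u).procs i).responders := by
    intro j
    by_cases hj : j ∈ E.faulty
    · exact ⟨0, fun h' => absurd hj h'⟩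
    · obtain ⟨u, hu⟩ := exists_mem_responders hE hi hj (hbp T hT).1 hrid
      exact ⟨u, fun _ => hu⟩
  choose u hu using hall
  -- By time `U` every correct process has been heard from; the times chosen for faulty ones are
  -- arbitrary.
  set U := Finset.univ.sup u
  have hsub : E.faultyᶜ ⊆ ↑((E.config U).procs i).responders := fun j hj =>
    hmono (u j) U (hu j hj).1 (Finset.le_sup (Finset.mem_univ j)) (hu j hj).2
  have h1 := Set.ncard_le_ncard hsub (Finset.finite_toSet _)
  rw [Set.ncard_coe_finset] at h1
  have h2 := Set.ncard_add_ncard_compl E.faulty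
  rw [Nat.card_fin] at h2
  obtain ⟨g, hg⟩ := (invariant E U).client i
  -- At least `n - f > n / 2` responders, yet fewer than `n / 2 + 1`.
  have h3 := hg.state.card_responders_lt
  unfold quorum at h3
  omega

theorem Execution.terminates_of_eventualDelivery {f : ℕ} (hf : 2 * f < n)
    (hfaulty : E.faulty.ncard ≤ f) (hE : E.EventualDelivery) : E.Terminates := by
  intro k i o hk hi
  obtain ⟨t₀, h, rfl⟩ := compact_get?_eq_some.1 hk
  obtain ⟨t, a, ht, hr⟩ := Execution.exists_response hf hfaulty hE hi h
  exact (completesAt_count_iff h).2 (completesBetween_of_response h ht hr)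

end Termination

/-! ### Linearization in logical time -/

section Linearization

variable {X : Type*} {n : ℕ} {E : Execution X n}

theorem lt_of_tsvTime_lt {σ τ : TSV} (h : tsvTime σ < tsvTime τ) : σ < τ :=
  Prod.Lex.lt_iff.2 (Or.inl (Prod.Lex.lt_iff.2 (Or.inl h)))

theorem Execution.clock_lt_of_inv {t : ℕ} {i : Fin n} {o : Op X}
    (h : E.event t = some (.inv i o)) : E.clock t i < E.clock (t + 1) i := by
  unfold Execution.clock
  rcases (E.trans t).elim_cases with ⟨-, -, -, he, -⟩ | ⟨k, o', -, he, hp, -⟩ |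
    ⟨j, k, M, rest, -, -, he, -⟩
  · rw [he] at h
    cases h
  · rw [he] at h
    cases h
    rw [hp, Function.update_self]
    exact (onInvoke_mono _ _ _).1
  · rw [he, Option.map_eq_some_iff] at h
    obtain ⟨a, -, ha⟩ := h
    cases ha

theorem exists_mem_of_card_eq_quorum {Q Q' : Finset (Fin n)} (h : Q.card = quorum n)
    (h' : Q'.card = quorum n) : ∃ j, j ∈ Q ∧ j ∈ Q' := by
  by_contra hcon
  push Not at hcon
  have h1 := Finset.card_union_of_disjoint (Finset.disjoint_left.2 hcon)
  have h2 := Finset.card_le_univ (Q ∪ Q')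
  rw [Fintype.card_fin] at h2
  unfold quorum at h h'
  omega

/-- A majority that secured `σ` and a majority that was sampled later in logical time have a
common member. -/
theorem Execution.le_of_secured_of_sampled {Q Q' : Finset (Fin n)} (h : Q.card = quorum n)
    (h' : Q'.card = quorum n) {l l' : ℕ} (hl : l < l') {r : X} {σ τ : TSV}
    (hσ : ∀ j ∈ Q, E.Secured l j r σ) (hτ : ∀ j ∈ Q', E.Sampled l' j r τ) : σ ≤ τ := by
  obtain ⟨j, hj, hj'⟩ := exists_mem_of_card_eq_quorum h h'
  obtain ⟨u, hu, hσu⟩ := hσ j hj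
  obtain ⟨v, hv, hτv⟩ := hτ j hj'
  have huv : u ≤ v := by
    by_contra hlt
    have : E.clock v j ≤ E.clock u j := E.clock_mono j (not_le.1 hlt).le
    omega
  exact hσu.trans ((E.stored_mono j r huv).trans hτv)

theorem exists_completesBetween_opRecord (hH : E.history.Complete) {t : ℕ} {i : Fin n} {o : Op X}
    (h : E.event t = some (.inv i o)) :
    ∃ u a τ, CompletesBetween E.event t u i o a ∧ OpRecord E t u i o a τ := by
  obtain ⟨u, a, hC⟩ := (completesAt_count_iff h).1 (hH _ _ _ (compact_get?_eq_some.2 ⟨t, h, rfl⟩))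
  obtain ⟨t₀, o', τ, hpend, -, hR⟩ := exists_opRecord hC.2.2.1
  obtain ⟨rfl, rfl⟩ := hpend.unique (⟨hC.1, h, hC.2.2.2.2⟩ : E.Pending t i o u)
  exact ⟨u, a, τ, hC, hR⟩

/-- The operation is a read. -/
def Op.isRead : Op X → Bool
  | .read _ => true
  | .write _ _ => false

theorem Execution.sc_of_complete (hH : E.history.Complete) : E.history.SC := by
  -- Operations are identified with their invocation times.
  let O := {t : ℕ // ∃ i o, E.event t = some (.inv i o)}
  have hex : ∀ x : O, ∃ i o u a τ, CompletesBetween E.event x.1 u i o a ∧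
      OpRecord E x.1 u i o a τ := by
    rintro ⟨t, i, o, h⟩
    exact ⟨i, o, exists_completesBetween_opRecord hH h⟩
  choose P o tr a τ hC hR using hex
  let L : O → ℕ := fun x => E.clock (x.1 + 1) (P x)
  let R : O → ℕ := fun x => E.clock (tr x + 1) (P x)
  -- Process indices are below `n`, so this encodes the lexicographic order of (L, process) in the
  -- naturals, where only finitely many values lie below a given one.
  let stamp : O → ℕ := fun x => L x * n + (P x : ℕ)
  have hLR : ∀ x, L x ≤ R x := fun x => (hR x).clock
  have hnext : ∀ x y, P x = P y → x.1 < y.1 → R x < L y := by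
    intro x y hP hxy
    have h1 : tr x < y.1 := (hC x).res_lt_inv (o' := o y) (by rw [(hC y).2.1, hP]) hxy
    have h2 : E.clock (tr x + 1) (P x) ≤ E.clock y.1 (P x) := E.clock_mono (P x) h1
    have h3 := E.clock_lt_of_inv (hC y).2.1
    change E.clock (tr x + 1) (P x) < E.clock (y.1 + 1) (P y)
    rw [← hP] at h3 ⊢
    omega
  have hunique : ∀ x y, L x = L y → P x = P y → x = y := by
    intro x y hL hP
    have h1 := hLR x
    have h2 := hLR y
    rcases lt_trichotomy x.1 y.1 with h | h | h
    · have := hnext x y hP h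
      omega
    · exact Subtype.ext h
    · have := hnext y x hP.symm h
      omega
  have hstamp_lt : ∀ x m, L x < m → stamp x < m * n := by
    intro x m h
    have h1 := Nat.mul_le_mul_right n (Nat.succ_le_of_lt h)
    have h2 := (P x).isLt
    have h3 : (L x).succ * n = L x * n + n := Nat.succ_mul _ _
    change L x * n + (P x : ℕ) < _
    omega
  have hle_stamp : ∀ x m, m ≤ L x → m * n ≤ stamp x := fun x m h =>
    (Nat.mul_le_mul_right n h).trans (Nat.le_add_right _ _)
  have hstamp : Function.Injective stamp := by
    intro x y h
    have hL : L x = L y := by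
      rcases lt_trichotomy (L x) (L y) with h' | h' | h'
      · exact absurd h ((hstamp_lt x _ h').trans_le (hle_stamp y _ le_rfl)).ne
      · exact h'
      · exact absurd h ((hstamp_lt y _ h').trans_le (hle_stamp x _ le_rfl)).ne'
    refine hunique x y hL (Fin.ext ?_)
    change L x * n + (P x : ℕ) = L y * n + (P y : ℕ) at h
    rw [hL] at h
    omega
  -- As `false < true`, a write comes before the reads of its pair; the stamp orders these reads
  -- among themselves.
  let rk : O → TSV ×ₗ (Bool ×ₗ ℕ) := fun x => toLex (τ x, toLex ((o x).isRead, stamp x))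
  have hrk_inj : Function.Injective rk := by
    intro x y h
    exact hstamp (congrArg (fun z => (ofLex (ofLex z).2).2) h)
  have hrk_fst : ∀ x y, rk x ≤ rk y → τ x ≤ τ y := fun x y h => Prod.Lex.monotone_fst _ _ h
  -- Contrapositively, `R x < L y` forces `rk x < rk y`: by the timestamp if `y` is a write, by
  -- intersecting majorities if it is a read.
  have hoverlap : ∀ x y, (o y).reg = (o x).reg → rk y ≤ rk x → L y ≤ R x := by
    intro x y hreg hle
    by_contra hlt
    rw [not_le] at hlt
    refine hle.not_gt ?_
    cases hoy : o y with
    | write r v =>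
      refine Prod.Lex.lt_iff.2 (Or.inl (lt_of_tsvTime_lt ?_))
      have h1 := (hR x).time_le
      have h2 : tsvTime (τ y) = L y := by rw [(hR y).write r v hoy]; rfl
      change tsvTime (τ x) < tsvTime (τ y)
      rw [h2]
      exact h1.trans_lt hlt
    | read r =>
      rw [hoy] at hreg
      obtain ⟨-, Q', hQ', hτ⟩ := (hR y).read r hoy
      obtain ⟨Q, hQ, hσ⟩ := (hR x).secured
      rw [← hreg] at hσ
      have hττ : τ x ≤ τ y := E.le_of_secured_of_sampled hQ hQ' hlt hσ hτ
      rcases hττ.lt_or_eq with h | h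
      · exact Prod.Lex.lt_iff.2 (Or.inl h)
      · refine Prod.Lex.lt_iff.2 (Or.inr ⟨h, ?_⟩)
        have hs : stamp x < stamp y :=
          (hstamp_lt x _ ((hLR x).trans_lt hlt)).trans_le (hle_stamp y _ le_rfl)
        have hy : (o y).isRead = true := by rw [hoy]; rfl
        change toLex ((o x).isRead, stamp x) < toLex ((o y).isRead, stamp y)
        rw [hy, Prod.Lex.toLex_lt_toLex]
        cases hx : (o x).isRead
        · exact Or.inl Bool.false_lt_true
        · exact Or.inr ⟨rfl, hs⟩
  -- The supremum of these stamps is the linearization point of `x`. It is at least `stamp x`, it is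
  -- below `(R x + 1) * n` by `hoverlap`, and it is monotone in `rk` on each register.
  let A : O → Set ℕ := fun x => stamp '' {y | (o y).reg = (o x).reg ∧ rk y ≤ rk x}
  have hA_lt : ∀ x, ∀ m ∈ A x, m < (R x + 1) * n := by
    rintro x _ ⟨y, ⟨h1, h2⟩, rfl⟩
    exact hstamp_lt y _ (Nat.lt_succ_of_le (hoverlap x y h1 h2))
  have hA_bdd : ∀ x, BddAbove (A x) := fun x => ⟨_, fun m hm => (hA_lt x m hm).le⟩
  have hA_mem : ∀ x, stamp x ∈ A x := fun x => ⟨x, ⟨rfl, le_rfl⟩, rfl⟩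
  let K : O → ℕ := fun x => sSup (A x)
  have hstamp_le : ∀ x, stamp x ≤ K x := fun x => le_csSup (hA_bdd x) (hA_mem x)
  have hK_lt : ∀ x, K x < (R x + 1) * n := fun x =>
    hA_lt x _ (Nat.sSup_mem ⟨_, hA_mem x⟩ (hA_bdd x))
  have hK_mono : ∀ x y, (o x).reg = (o y).reg → rk x ≤ rk y → K x ≤ K y := by
    intro x y hreg hle
    refine csSup_le_csSup (hA_bdd y) ⟨_, hA_mem x⟩ ?_
    rintro _ ⟨z, ⟨h1, h2⟩, rfl⟩
    exact ⟨z, ⟨h1.trans hreg, h2.trans hle⟩, rfl⟩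
  let key : O → ℕ ×ₗ (TSV ×ₗ (Bool ×ₗ ℕ)) := fun x => toLex (K x, rk x)
  have hkey_inj : Function.Injective key := fun x y h =>
    hrk_inj (congrArg (fun z => (ofLex z).2) h)
  have hkey_of_K : ∀ x y, K x < K y → key x < key y := fun x y h =>
    Prod.Lex.lt_iff.2 (Or.inl h)
  have hkey_iff : ∀ x y, (o x).reg = (o y).reg → (key x < key y ↔ rk x < rk y) := by
    have haux : ∀ x y, (o x).reg = (o y).reg → rk x < rk y → key x < key y := by
      intro x y hreg h
      rcases (hK_mono x y hreg h.le).lt_or_eq with h' | h'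
      · exact hkey_of_K x y h'
      · exact Prod.Lex.lt_iff.2 (Or.inr ⟨h', h⟩)
    refine fun x y hreg => ⟨fun h => ?_, haux x y hreg⟩
    by_contra hle
    rcases (not_lt.1 hle).lt_or_eq with h' | h'
    · exact (haux y x hreg.symm h').not_gt h
    · rw [hrk_inj h'] at h
      exact lt_irrefl _ h
  refine @sc_of_linearOrder X n O (LinearOrder.lift' key hkey_inj) E.event P o a Subtype.val tr hC
    ?_ Subtype.val_injective ?_ ?_ ?_
  · intro t e he
    cases e with
    | inv i op => exact ⟨⟨t, i, op, he⟩, Or.inl rfl⟩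
    | res i b =>
      obtain ⟨t₀, op, -, hpend, -⟩ := exists_opRecord he
      let x : O := ⟨t₀, i, op, hpend.2.1⟩
      have hPx : P x = i := by
        have := (hC x).2.1.symm.trans hpend.2.1
        simp only [Option.some.injEq, Event.inv.injEq] at this
        exact this.1
      refine ⟨x, Or.inr ?_⟩
      obtain ⟨h1, -, h2, -, h3⟩ := hC x
      rcases lt_trichotomy t (tr x) with h | h | h
      · exact absurd hPx.symm (h3 t _ hpend.1 h he)
      · exact h
      · exact absurd hPx (hpend.2.2 (tr x) _ h1 h h2)
  · intro x y hP hxy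
    -- The chain is `K x < (R x + 1) * n ≤ L y * n ≤ stamp y ≤ K y`.
    refine hkey_of_K x y ((hK_lt x).trans_le ?_)
    exact (hle_stamp y _ (hnext x y hP hxy)).trans (hstamp_le y)
  · intro x
    refine ((Set.finite_Iic (K x)).preimage hstamp.injOn).subset fun y hy => ?_
    have hy' : key y < key x := hy
    exact (hstamp_le y).trans (Prod.Lex.monotone_fst _ _ hy'.le)
  · intro x r v hox hax
    have hval : v = (ofLex (τ x)).2 := by
      have := ((hR x).read r hox).1
      rw [hax] at this
      cases this
      rfl
    have hknown : E.Known r (τ x) := by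
      have := (hR x).known
      rwa [hox] at this
    have hwrite : ∀ y w, o y = .write r w → key y < key x → τ y ≤ τ x := fun y w hy h =>
      hrk_fst y x ((hkey_iff y x (by rw [hox, hy]; rfl)).1 h).le
    rcases hknown with h0 | ⟨t, i, w, he, hτ⟩
    · refine Or.inl ⟨by rw [hval, h0]; rfl, fun y w hy (hyx : key y < key x) => ?_⟩
      have hle := hwrite y w hy hyx
      -- An invocation raises the clock, so the pair of a write has positive time and exceeds the
      -- initial pair.
      refine hle.not_gt (lt_of_tsvTime_lt ?_)
      rw [h0, (hR y).write r w hy]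
      exact (Nat.zero_le _).trans_lt (E.clock_lt_of_inv (hC y).2.1)
    · let y : O := ⟨t, i, _, he⟩
      have hPo : P y = i ∧ o y = .write r w := by
        have := (hC y).2.1.symm.trans he
        simpa only [Option.some.injEq, Event.inv.injEq] using this
      obtain ⟨hPy, hoy⟩ := hPo
      have hτy : τ y = τ x := by
        rw [hτ, (hR y).write r w hoy, hPy]
      refine Or.inr ⟨y, ?_, ?_, ?_⟩
      · rw [hoy, hval, hτ]
        rfl
      · refine (hkey_iff y x (by rw [hox, hoy]; rfl)).2 ?_
        refine Prod.Lex.lt_iff.2 (Or.inr ⟨hτy, ?_⟩)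
        change toLex ((o y).isRead, stamp y) < toLex ((o x).isRead, stamp x)
        rw [hox, hoy]
        exact Prod.Lex.toLex_lt_toLex.2 (Or.inl Bool.false_lt_true)
      · intro z w' hoz (hyz : key y < key z) (hzx : key z < key x)
        have h1 := hwrite z w' hoz hzx
        have h2 := hrk_fst y z ((hkey_iff y z (by rw [hoy, hoz]; rfl)).1 hyz).le
        -- A write between `y` and `x` would have the pair of `y`, hence the same logical time and
        -- process, and so would be `y` itself.
        have h3 : τ z = τ y := le_antisymm (h1.trans hτy.ge) h2
        rw [(hR z).write r w' hoz, (hR y).write r w hoy] at h3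
        have h4 : L z = L y := congrArg tsvTime h3
        have h5 : pid (P z) = pid (P y) :=
          congrArg (fun σ : TSV => (ofLex (ofLex σ).1).2) h3
        have h6 : z = y := hunique z y h4 (Fin.ext (Nat.succ_injective h5))
        rw [h6] at hyz
        exact lt_irrefl _ hyz

end Linearization

end SCABD

theorem mainTheorem1 {X : Type*} {n f : ℕ} (hf : 2 * f < n) (E : SCABD.Execution X n)
    (hE : E.faulty.ncard ≤ f) :
    (E.EventualDelivery → E.Terminates) ∧ (E.history.Complete → E.history.SC) :=
  ⟨fun h => E.terminates_of_eventualDelivery hf hE h, fun h => E.sc_of_complete h⟩
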